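/- Let $\mathbb F$ be a field. Identify $\mathrm{AGL}_4(\mathbb F)$ with the group of invertible $5\times 5$ matrices over $\mathbb F$ with first column $(1,0,0,0,0)^{T}$. A subgroup $R\le \mathrm{AGL}_4(\mathbb F)$ is called regular if for every $v\in\mathbb F^4$ there is a unique element of $R$ with first row $(1,v)$. For $\alpha,\beta\in\mathbb F$ and $D\in\mathrm{Mat}_3(\mathbb F)$ consider the following sets of matrices, where $x_1,x_2,x_3,x_4$ range over $\mathbb F$ and $X=(x_1,x_2,x_3)$: $$S_{(5)}=\begin{pmatrix}1&x_1&x_2&x_3&x_4\\0&1&x_1&x_2&x_3\\0&0&1&x_1&x_2\\0&0&0&1&x_1\\0&0&0&0&1\end{pmatrix},\quad S_{(4,1)}=\begin{pmatrix}1&x_1&x_2&x_3&x_4\\0&1&x_1&x_2&0\\0&0&1&x_1&0\\0&0&0&1&0\\0&0&0&0&1\end{pmatrix},\quad S^{\sharp}_{(3,2)}=\begin{pmatrix}1&x_1&x_2&x_3&x_4\\0&1&x_1&0&x_2\\0&0&1&0&x_1\\0&0&0&1&x_3\\0&0&0&0&1\end{pmatrix},$$ $$U_1(\alpha,\beta)=\begin{pmatrix}1&x_1&x_2&x_3&x_4\\0&1&0&x_1&x_2\\0&0&1&\beta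 x_2&x_1+\alpha x_2\\0&0&0&1&0\\0&0&0&0&1\end{pmatrix},\quad \mathcal R_D=\begin{pmatrix}1&X&x_4\\0&I_3&DX^{T}\\0&0&1\end{pmatrix}.$$ Fix a transversal $\mathbb F^\square$ for $(\mathbb F^*)^2$ in $\mathbb F^*$, and a complete set $\Pi_S(\mathbb F)$ of representatives of the projective congruence classes of symmetric matrices in $\mathrm{Mat}_3(\mathbb F)$, where $A,B$ are projectively congruent if $PAP^{T}=\lambda B$ for some $P\in\mathrm{GL}_3(\mathbb F)$ and $\lambda\in\mathbb F^*$. If $\mathrm{char}\,\mathbb F=2$, fix also a transversal $\mathsf B(\mathbb F)$ for the additive subgroup $\{\lambda^2+\lambda:\lambda\in\mathbb F\}$ in $\mathbb F$, and a set $\mathsf C(\mathbb F)\subseteq\mathbb F^\square$ of representatives for the equivalence relation $\star$ on $\mathbb F^\square$ given by $\rho_1\star\rho_2$ if and only if $\rho_2=\frac{x_1^2+x_2^2\rho_1}{x_3^2+x_4^2\rho_1}$ for some $x_1,x_2,x_3,x_4\in\mathbb F$ with $x_1x_4\ne x_2x_3$ and nonzero denominator. Theorem. The following are abelian regular subgroups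 of $\mathrm{AGL}_4(\mathbb F)$, every abelian regular subgroup of $\mathrm{AGL}_4(\mathbb F)$ is conjugate in $\mathrm{AGL}_4(\mathbb F)$ to one of them, and no two differently labelled ones are conjugate in $\mathrm{AGL}_4(\mathbb F)$: - $S_{(5)}$, $S_{(4,1)}$, $S^{\sharp}_{(3,2)}$; - if $\mathrm{char}\,\mathbb F\neq 2$: $U_1(0,0)$ and $U_1(0,\rho)$ with $\rho\in\mathbb F^\square$; - if $\mathrm{char}\,\mathbb F=2$: $U_1(0,\rho)$ with $\rho\in\mathsf C(\mathbb F)$, and $U_1(1,\epsilon)$ with $\epsilon\in\mathsf B(\mathbb F)$; - $\mathcal R_D$ with $D\in\Pi_S(\mathbb F)$. -/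

import Mathlib

/-- The affine group `AGL_n(F)`: the invertible `(n+1) × (n+1)` matrices whose first column is
`(1, 0, …, 0)ᵀ`.  It acts on the right on the affine points `(1, v)`, `v ∈ F ^ n`. -/
def AGL (n : ℕ) (F : Type*) [Field F] : Subgroup (Matrix.GeneralLinearGroup (Fin (n + 1)) F) where
  carrier := {g | ∀ i, g.val i 0 = if i = 0 then 1 else 0}
  mul_mem' := by
    intro a b ha hb i
    change ∀ i, a.val i 0 = _ at ha
    change ∀ i, b.val i 0 = _ at hb
    change (a.val * b.val) i 0 = _
    simp [Matrix.mul_apply, hb, ha]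
  one_mem' := by
    intro i
    simp [Matrix.one_apply]
  inv_mem' := by
    intro a ha i
    change ∀ i, a.val i 0 = _ at ha
    change a⁻¹.val i 0 = _
    have h : (a⁻¹.val * a.val) i 0 = a⁻¹.val i 0 := by
      simp [Matrix.mul_apply, ha]
    have h1 : a⁻¹.val * a.val = 1 := a.inv_mul
    rw [← h, h1, Matrix.one_apply]

namespace AGL

variable {F : Type*} [Field F]

/-- The underlying matrix of an element of the affine group. -/
def mat {n : ℕ} (g : AGL n F) : Matrix (Fin (n + 1)) (Fin (n + 1)) F := g.val.val

/-- A subgroup is regular if for every `v` it has exactly one element with first row `(1, v)`. -/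
def IsRegular {n : ℕ} (R : Subgroup (AGL n F)) : Prop :=
  ∀ v : Fin n → F, ∃! r : AGL n F, r ∈ R ∧ mat r 0 = Matrix.vecCons 1 v

def IsAbelian {n : ℕ} (R : Subgroup (AGL n F)) : Prop :=
  ∀ a ∈ R, ∀ b ∈ R, a * b = b * a

/-- Conjugacy of subgroups under the affine group. -/
def AreConj {n : ℕ} (R S : Subgroup (AGL n F)) : Prop :=
  ∃ g : AGL n F, R.map (MulAut.conj g).toMonoidHom = S

/-- The subgroup of all elements with matrix `M x`, where `x` runs over `F ^ 4`. -/
def ofMatrices (M : (Fin 4 → F) → Matrix (Fin 5) (Fin 5) F)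
    (hmul : ∀ x y, ∃ z, M x * M y = M z) (hinv : ∀ x, ∃ y, M x * M y = 1) :
    Subgroup (AGL 4 F) where
  carrier := {g | ∃ x, mat g = M x}
  mul_mem' := by
    rintro a b ⟨x, hx⟩ ⟨y, hy⟩
    obtain ⟨z, hz⟩ := hmul x y
    exact ⟨z, by rw [← hz, ← hx, ← hy]; rfl⟩
  one_mem' := by
    obtain ⟨y, hy⟩ := hinv 0
    obtain ⟨z, hz⟩ := hmul 0 y
    exact ⟨z, by rw [← hz, hy]; rfl⟩
  inv_mem' := by
    rintro a ⟨x, hx⟩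
    obtain ⟨y, hy⟩ := hinv x
    refine ⟨y, ?_⟩
    have h1 : mat a⁻¹ * mat a = 1 := a.val.inv_mul
    calc mat a⁻¹ = mat a⁻¹ * (M x * M y) := by rw [hy, mul_one]
      _ = M y := by rw [← hx, ← mul_assoc, h1, one_mul]

def matS5 (x : Fin 4 → F) : Matrix (Fin 5) (Fin 5) F :=
  !![1, x 0, x 1, x 2, x 3;
     0, 1, x 0, x 1, x 2;
     0, 0, 1, x 0, x 1;
     0, 0, 0, 1, x 0;
     0, 0, 0, 0, 1]

def matS41 (x : Fin 4 → F) : Matrix (Fin 5) (Fin 5) F :=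
  !![1, x 0, x 1, x 2, x 3;
     0, 1, x 0, x 1, 0;
     0, 0, 1, x 0, 0;
     0, 0, 0, 1, 0;
     0, 0, 0, 0, 1]

def matS32 (x : Fin 4 → F) : Matrix (Fin 5) (Fin 5) F :=
  !![1, x 0, x 1, x 2, x 3;
     0, 1, x 0, 0, x 1;
     0, 0, 1, 0, x 0;
     0, 0, 0, 1, x 2;
     0, 0, 0, 0, 1]

def matU1 (α β : F) (x : Fin 4 → F) : Matrix (Fin 5) (Fin 5) F :=
  !![1, x 0, x 1, x 2, x 3;
     0, 1, 0, x 0, x 1;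
     0, 0, 1, β * x 1, x 0 + α * x 1;
     0, 0, 0, 1, 0;
     0, 0, 0, 0, 1]

def matR (D : Matrix (Fin 3) (Fin 3) F) (x : Fin 4 → F) : Matrix (Fin 5) (Fin 5) F :=
  !![1, x 0, x 1, x 2, x 3;
     0, 1, 0, 0, D 0 0 * x 0 + D 0 1 * x 1 + D 0 2 * x 2;
     0, 0, 1, 0, D 1 0 * x 0 + D 1 1 * x 1 + D 1 2 * x 2;
     0, 0, 0, 1, D 2 0 * x 0 + D 2 1 * x 1 + D 2 2 * x 2;
     0, 0, 0, 0, 1]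

theorem one_eq : (1 : Matrix (Fin 5) (Fin 5) F) =
    !![1, 0, 0, 0, 0; 0, 1, 0, 0, 0; 0, 0, 1, 0, 0; 0, 0, 0, 1, 0; 0, 0, 0, 0, 1] := by
  ext i j
  fin_cases i <;> fin_cases j <;> rfl

/-- The subgroup `S_(5)`. -/
def S5 (F : Type*) [Field F] : Subgroup (AGL 4 F) := ofMatrices matS5
  (by
    intro x y
    refine ⟨![x 0 + y 0, x 1 + x 0 * y 0 + y 1, x 2 + x 1 * y 0 + x 0 * y 1 + y 2,
      x 3 + x 2 * y 0 + x 1 * y 1 + x 0 * y 2 + y 3], ?_⟩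
    simp [matS5]
    repeat' apply And.intro
    all_goals ring)
  (by
    intro x
    refine ⟨![-x 0, x 0 ^ 2 - x 1, -x 0 ^ 3 + 2 * x 0 * x 1 - x 2,
      x 0 ^ 4 - 3 * x 0 ^ 2 * x 1 + x 1 ^ 2 + 2 * x 0 * x 2 - x 3], ?_⟩
    simp [matS5, one_eq]
    repeat' apply And.intro
    all_goals ring)

/-- The subgroup `S_(4,1)`. -/
def S41 (F : Type*) [Field F] : Subgroup (AGL 4 F) := ofMatrices matS41
  (by
    intro x y
    refine ⟨![x 0 + y 0, x 1 + x 0 * y 0 + y 1, x 2 + x 1 * y 0 + x 0 * y 1 + y 2,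
      x 3 + y 3], ?_⟩
    simp [matS41]
    repeat' apply And.intro
    all_goals ring)
  (by
    intro x
    refine ⟨![-x 0, x 0 ^ 2 - x 1, -x 0 ^ 3 + 2 * x 0 * x 1 - x 2, -x 3], ?_⟩
    simp [matS41, one_eq]
    repeat' apply And.intro
    all_goals ring)

/-- The subgroup `S♯_(3,2)`. -/
def S32 (F : Type*) [Field F] : Subgroup (AGL 4 F) := ofMatrices matS32
  (by
    intro x y
    refine ⟨![x 0 + y 0, x 1 + x 0 * y 0 + y 1, x 2 + y 2,
      x 3 + x 1 * y 0 + x 0 * y 1 + x 2 * y 2 + y 3], ?_⟩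
    simp [matS32]
    repeat' apply And.intro
    all_goals ring)
  (by
    intro x
    refine ⟨![-x 0, x 0 ^ 2 - x 1, -x 2,
      -x 0 ^ 3 + 2 * x 0 * x 1 + x 2 ^ 2 - x 3], ?_⟩
    simp [matS32, one_eq]
    repeat' apply And.intro
    all_goals ring)

/-- The subgroup `U_1(α, β)`. -/
def U1 (α β : F) : Subgroup (AGL 4 F) := ofMatrices (matU1 α β)
  (by
    intro x y
    refine ⟨![x 0 + y 0, x 1 + y 1, x 2 + x 0 * y 0 + x 1 * (β * y 1) + y 2,
      x 3 + x 0 * y 1 + x 1 * (y 0 + α * y 1) + y 3], ?_⟩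
    simp [matU1]
    repeat' apply And.intro
    all_goals ring)
  (by
    intro x
    refine ⟨![-x 0, -x 1, x 0 ^ 2 + β * x 1 ^ 2 - x 2,
      2 * x 0 * x 1 + α * x 1 ^ 2 - x 3], ?_⟩
    simp [matU1, one_eq]
    repeat' apply And.intro
    all_goals ring)

/-- The subgroup `R_D`. -/
def RR (D : Matrix (Fin 3) (Fin 3) F) : Subgroup (AGL 4 F) := ofMatrices (matR D)
  (by
    intro x y
    refine ⟨![x 0 + y 0, x 1 + y 1, x 2 + y 2, y 3 +
      (x 0 * (D 0 0 * y 0 + D 0 1 * y 1 + D 0 2 * y 2) +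
      x 1 * (D 1 0 * y 0 + D 1 1 * y 1 + D 1 2 * y 2) +
      x 2 * (D 2 0 * y 0 + D 2 1 * y 1 + D 2 2 * y 2) + x 3)], ?_⟩
    simp [matR]
    repeat' apply And.intro
    all_goals ring)
  (by
    intro x
    refine ⟨![-x 0, -x 1, -x 2,
      x 0 * (D 0 0 * x 0 + D 0 1 * x 1 + D 0 2 * x 2) +
      x 1 * (D 1 0 * x 0 + D 1 1 * x 1 + D 1 2 * x 2) +
      x 2 * (D 2 0 * x 0 + D 2 1 * x 1 + D 2 2 * x 2) - x 3], ?_⟩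
    simp [matR, one_eq]
    repeat' apply And.intro
    all_goals ring)

/-- `T` is a complete set of representatives in `X` of the classes of the relation `r`. -/
def IsRepSet {A : Type*} (X : Set A) (r : A → A → Prop) (T : Set A) : Prop :=
  T ⊆ X ∧ ∀ a ∈ X, ∃! t, t ∈ T ∧ r a t

/-- Projective congruence of square matrices. -/
def ProjCongruent {n : ℕ} (A B : Matrix (Fin n) (Fin n) F) : Prop :=
  ∃ c : F, c ≠ 0 ∧ ∃ P : Matrix (Fin n) (Fin n) F, IsUnit P ∧ P * A * P.transpose = c • B

/-- `T` is a transversal for the nonzero squares in the multiplicative group of `F`. -/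
def IsSquareTransversal (T : Set F) : Prop :=
  IsRepSet {a : F | a ≠ 0} (fun a b => ∃ w : F, w ≠ 0 ∧ a = w ^ 2 * b) T

/-- `T` is a transversal in `F` for `{l ^ 2 + l : l ∈ F}`, an additive subgroup in
characteristic two. -/
def IsArtinSchreierTransversal (T : Set F) : Prop :=
  IsRepSet (Set.univ : Set F) (fun a b => ∃ l : F, a - b = l ^ 2 + l) T

/-- The relation `⋆`. -/
def Star (a b : F) : Prop :=
  ∃ x₁ x₂ x₃ x₄ : F, x₁ * x₄ ≠ x₂ * x₃ ∧ x₃ ^ 2 + x₄ ^ 2 * a ≠ 0 ∧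
    b = (x₁ ^ 2 + x₂ ^ 2 * a) / (x₃ ^ 2 + x₄ ^ 2 * a)

/-- `T` is a complete set of representatives of projective congruence classes of symmetric
`3 × 3` matrices. -/
def IsSymmRepSet (T : Set (Matrix (Fin 3) (Fin 3) F)) : Prop :=
  IsRepSet {A : Matrix (Fin 3) (Fin 3) F | A.IsSymm} ProjCongruent T

/-- Names of the subgroups from which the list is drawn. -/
inductive Label (F : Type*) : Type _
  | S5 : Label F
  | S41 : Label F
  | S32 : Label F
  | U1 (α β : F) : Label F
  | RR (D : Matrix (Fin 3) (Fin 3) F) : Label F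

/-- The subgroup with a given name. -/
def Label.group : Label F → Subgroup (AGL 4 F)
  | .S5 => AGL.S5 F
  | .S41 => AGL.S41 F
  | .S32 => AGL.S32 F
  | .U1 α β => AGL.U1 α β
  | .RR D => AGL.RR D

/-- The names that are actually listed, for given sets of representatives `Q` (of `Fˣ` modulo
squares), `B`, `C` (used in characteristic two) and `P` (symmetric matrices). -/
def Label.Listed (Q B C : Set F) (P : Set (Matrix (Fin 3) (Fin 3) F)) : Label F → Prop
  | .S5 => True
  | .S41 => True
  | .S32 => True
  | .U1 α β =>
      (ringChar F ≠ 2 ∧ α = 0 ∧ (β = 0 ∨ β ∈ Q)) ∨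
      (ringChar F = 2 ∧ α = 0 ∧ β ∈ C) ∨
      (ringChar F = 2 ∧ α = 1 ∧ β ∈ B)
  | .RR D => D ∈ P

end AGL

/-! An abelian regular subgroup turns `F ^ n` into a commutative associative algebra. If `L_v` is
the linear part of the element with translation part `v`, the product is `x ∘ v = x L_v - x`. It is
commutative because the group is, and associative because the group is closed under multiplication.
Invertibility of `L_v` says that `y + v y = 0` forces `y = 0`; in finite dimension this plays the
role of nilpotency. Conjugacy of groups is isomorphism of algebras (`areConj_of_equiv`,
`exists_equiv_of_areConj`), so the task is to classify the four-dimensional algebras `A` of this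
kind.

If some `x⁴ ≠ 0`, the powers of `x` form a basis. If `x³ ≠ 0` and `x⁴ = 0`, there is a complementary
`z` with `x z = 0` and `z² = r x³`, and the two cases are `r = 0` and `r ≠ 0`. If all cubes vanish,
counting dimensions gives `A³ = 0` in every characteristic (`mul_mul_eq_zero_of_cubes`). Then either
all products lie on one line and the product is a symmetric bilinear form up to congruence and
scaling, or some `e₁²`, `e₁e₂` are independent. In the latter case `A` is governed by the single
relation `e₂² = β e₁² + α e₁e₂`, that is, by a binary quadratic form up to substitution and scaling.
It is classified by its discriminant modulo squares if `2 ≠ 0`. In characteristic two it is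
classified by its Arf invariant if `α ≠ 0`, and by the relation `⋆` if `α = 0`.

Nonvanishing fourth powers and cubes, whether annihilators are products, and whether products span
at most a line separate the families; within a family an isomorphism is read off on generators. -/

namespace AGL

/-! ### Affine transformations as pairs of a translation and a linear part -/

section Affine

variable {F : Type*} [Field F] {n : ℕ}

open Matrix

/-- The translation part of an affine transformation. -/
def tr (g : AGL n F) : Fin n → F := fun j => mat g 0 j.succ

/-- The linear part of an affine transformation. -/
def lin (g : AGL n F) : Matrix (Fin n) (Fin n) F := fun i j => mat g i.succ j.succ

theorem mat_col_zero (g : AGL n F) (i : Fin (n + 1)) : mat g i 0 = if i = 0 then 1 else 0 :=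
  g.2 i

theorem mat_mul (g h : AGL n F) : mat (g * h) = mat g * mat h := rfl

theorem mat_one : mat (1 : AGL n F) = 1 := rfl

theorem mat_injective : Function.Injective (mat : AGL n F → _) := fun _ _ h =>
  Subtype.ext (Units.ext h)

theorem ext_parts {g h : AGL n F} (ht : tr g = tr h) (hl : lin g = lin h) : g = h := by
  apply mat_injective
  ext i j
  refine Fin.cases ?_ (fun j => ?_) j
  · rw [mat_col_zero, mat_col_zero]
  · refine Fin.cases ?_ (fun i => ?_) i
    · exact congrFun ht j
    · exact congrFun (congrFun hl i) j

theorem tr_mul (g h : AGL n F) : tr (g * h) = tr h + tr g ᵥ* lin h := by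
  ext j
  simp [tr, lin, mat_mul, Matrix.mul_apply, Fin.sum_univ_succ, mat_col_zero, vecMul, dotProduct]

theorem lin_mul (g h : AGL n F) : lin (g * h) = lin g * lin h := by
  ext i j
  simp [lin, mat_mul, Matrix.mul_apply, Fin.sum_univ_succ, mat_col_zero]

theorem lin_one : lin (1 : AGL n F) = 1 := by
  ext i j
  simp [lin, mat_one, Matrix.one_apply]

theorem lin_mul_lin_inv (g : AGL n F) : lin g * lin g⁻¹ = 1 := by
  rw [← lin_mul, mul_inv_cancel, lin_one]

theorem lin_inv_mul_lin (g : AGL n F) : lin g⁻¹ * lin g = 1 := by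
  rw [← lin_mul, inv_mul_cancel, lin_one]

theorem row_zero_eq_iff (g : AGL n F) (v : Fin n → F) :
    mat g 0 = Matrix.vecCons 1 v ↔ tr g = v := by
  constructor
  · intro h
    ext j
    simp [tr, h]
  · rintro rfl
    ext j
    refine Fin.cases ?_ (fun j => ?_) j
    · simp [mat_col_zero]
    · simp [tr]

theorem exists_mat_eq (M N : Matrix (Fin (n + 1)) (Fin (n + 1)) F) (h : M * N = 1)
    (h0 : ∀ i, M i 0 = if i = 0 then 1 else 0) : ∃ g : AGL n F, mat g = M :=
  ⟨⟨⟨M, N, h, mul_eq_one_comm.mp h⟩, h0⟩, rfl⟩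

theorem exists_linear (P Q : Matrix (Fin n) (Fin n) F) (h : P * Q = 1) :
    ∃ g : AGL n F, tr g = 0 ∧ lin g = P := by
  let E (P : Matrix (Fin n) (Fin n) F) : Matrix (Fin (n + 1)) (Fin (n + 1)) F :=
    Matrix.of (Fin.cons (Fin.cons 1 0) fun i => Fin.cons 0 (P i))
  have hE : E P * E Q = 1 := by
    ext i j
    refine Fin.cases ?_ (fun i => ?_) i <;> refine Fin.cases ?_ (fun j => ?_) j
    · simp [E, Matrix.mul_apply, Fin.sum_univ_succ]
    · simp [E, Matrix.mul_apply, Fin.sum_univ_succ, (Fin.succ_ne_zero _).symm]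
    · simp [E, Matrix.mul_apply, Fin.sum_univ_succ]
    · have := congrFun (congrFun h i) j
      simpa [E, Matrix.mul_apply, Fin.sum_univ_succ, Matrix.one_apply] using this
  obtain ⟨g, hg⟩ := exists_mat_eq (E P) (E Q) hE (by
    intro i
    refine Fin.cases ?_ (fun i => ?_) i <;> simp [E])
  refine ⟨g, ?_, ?_⟩
  · ext j
    simp [tr, hg, E]
  · ext i j
    simp [lin, hg, E]

/-! ### The algebra of an abelian regular subgroup -/

section Regular

variable {R S : Subgroup (AGL n F)}

theorem IsRegular.existsUnique_tr (hR : IsRegular R) (v : Fin n → F) :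
    ∃! r : AGL n F, r ∈ R ∧ tr r = v := by
  simpa only [row_zero_eq_iff] using hR v

/-- The element of a regular subgroup with a given translation part. -/
noncomputable def IsRegular.rep (hR : IsRegular R) (v : Fin n → F) : AGL n F :=
  (hR.existsUnique_tr v).choose

theorem IsRegular.rep_mem (hR : IsRegular R) (v : Fin n → F) : hR.rep v ∈ R :=
  (hR.existsUnique_tr v).choose_spec.1.1

theorem IsRegular.tr_rep (hR : IsRegular R) (v : Fin n → F) : tr (hR.rep v) = v :=
  (hR.existsUnique_tr v).choose_spec.1.2

theorem IsRegular.eq_rep (hR : IsRegular R) {r : AGL n F} (hr : r ∈ R) : r = hR.rep (tr r) :=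
  (hR.existsUnique_tr (tr r)).choose_spec.2 r ⟨hr, rfl⟩

/-- The product on the affine space given by a regular subgroup. -/
noncomputable def IsRegular.prod (hR : IsRegular R) (x v : Fin n → F) : Fin n → F :=
  x ᵥ* lin (hR.rep v) - x

theorem IsRegular.vecMul_lin_rep (hR : IsRegular R) (x v : Fin n → F) :
    x ᵥ* lin (hR.rep v) = x + hR.prod x v := by
  simp [IsRegular.prod]

theorem IsRegular.prod_add_left (hR : IsRegular R) (x y v : Fin n → F) :
    hR.prod (x + y) v = hR.prod x v + hR.prod y v := by
  simp only [IsRegular.prod, add_vecMul]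
  abel

theorem IsRegular.prod_smul_left (hR : IsRegular R) (c : F) (x v : Fin n → F) :
    hR.prod (c • x) v = c • hR.prod x v := by
  simp only [IsRegular.prod, smul_vecMul, smul_sub]

theorem IsRegular.zero_prod (hR : IsRegular R) (v : Fin n → F) : hR.prod 0 v = 0 := by
  simp [IsRegular.prod]

/-- The translation parts of the two products of commuting elements are `v + x + x ∘ v` and `x + v +
v ∘ x`. -/
theorem IsRegular.prod_comm (hR : IsRegular R) (hA : IsAbelian R) (x v : Fin n → F) :
    hR.prod x v = hR.prod v x := by
  have h := congrArg tr (hA _ (hR.rep_mem x) _ (hR.rep_mem v))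
  rw [tr_mul, tr_mul, hR.tr_rep, hR.tr_rep, hR.vecMul_lin_rep, hR.vecMul_lin_rep,
    add_left_comm] at h
  exact add_left_cancel (add_left_cancel h)

theorem IsRegular.prod_add_right (hR : IsRegular R) (hA : IsAbelian R) (x y v : Fin n → F) :
    hR.prod v (x + y) = hR.prod v x + hR.prod v y := by
  simp only [hR.prod_comm hA v, hR.prod_add_left]

/-- The product of the elements over `y` and `z` is the element over `z + y + y ∘ z`; its action on
`x`, computed in both ways, gives the law after cancellation. -/
theorem IsRegular.prod_assoc (hR : IsRegular R) (hA : IsAbelian R) (x y z : Fin n → F) :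
    hR.prod (hR.prod x y) z = hR.prod x (hR.prod y z) := by
  have h := hR.eq_rep (R.mul_mem (hR.rep_mem y) (hR.rep_mem z))
  rw [tr_mul, hR.tr_rep, hR.tr_rep, hR.vecMul_lin_rep] at h
  have h2 := congrArg (fun g => x ᵥ* lin g) h
  simp only [lin_mul, ← vecMul_vecMul, hR.vecMul_lin_rep, hR.prod_add_left,
    hR.prod_add_right hA] at h2
  have h3 : ∀ a b c d e : Fin n → F, a + b + (c + d) = a + (c + (b + e)) → d = e := by
    intro a b c d e h
    have : a + b + c + d = a + b + c + e := by
      rw [add_assoc _ c d, h]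
      abel
    exact add_left_cancel this
  exact h3 _ _ _ _ _ h2

theorem IsRegular.eq_zero_of_add_prod (hR : IsRegular R) (y v : Fin n → F)
    (h : y + hR.prod y v = 0) : y = 0 := by
  rw [← hR.vecMul_lin_rep] at h
  have h2 := congrArg (fun z => z ᵥ* lin (hR.rep v)⁻¹) h
  simpa [vecMul_vecMul, lin_mul_lin_inv] using h2

/-- The commutative algebra attached to an abelian regular subgroup. -/
def RegAlg (_ : IsRegular R) (_ : IsAbelian R) : Type _ := Fin n → F

variable (hR : IsRegular R) (hA : IsAbelian R)

instance : AddCommGroup (RegAlg hR hA) := inferInstanceAs (AddCommGroup (Fin n → F))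

instance : Module F (RegAlg hR hA) := inferInstanceAs (Module F (Fin n → F))

/-- The type synonym keeps this product apart from the pointwise product of functions. -/
noncomputable instance : NonUnitalCommRing (RegAlg hR hA) where
  mul := hR.prod
  left_distrib a b c := hR.prod_add_right hA b c a
  right_distrib a b c := hR.prod_add_left a b c
  zero_mul := hR.zero_prod
  mul_zero a := (hR.prod_comm hA a 0).trans (hR.zero_prod a)
  mul_assoc := hR.prod_assoc hA
  mul_comm := hR.prod_comm hA

instance : IsScalarTower F (RegAlg hR hA) (RegAlg hR hA) where
  smul_assoc c x y := hR.prod_smul_left c x y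

instance : SMulCommClass F (RegAlg hR hA) (RegAlg hR hA) where
  smul_comm c x y := by
    change c • (x * y) = x * (c • y)
    rw [mul_comm x y, mul_comm x]
    exact (hR.prod_smul_left c y x).symm

theorem RegAlg.finrank_eq : Module.finrank F (RegAlg hR hA) = n :=
  Module.finrank_fin_fun F

theorem RegAlg.eq_zero_of_add_mul (v y : RegAlg hR hA) (h : y + v * y = 0) : y = 0 := by
  rw [mul_comm] at h
  exact hR.eq_zero_of_add_prod y v h

/-- An algebra isomorphism, read as an affine map fixing the origin, conjugates the element of `S`
over `x` to the element of `R` over `φ x`; translation and linear parts are compared separately. -/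
theorem areConj_of_equiv {hR : IsRegular R} (hS : IsRegular S)
    (φ : (Fin n → F) ≃ₗ[F] (Fin n → F))
    (hφ : ∀ x y, φ (hS.prod x y) = hR.prod (φ x) (φ y)) : AreConj R S := by
  have key (f : (Fin n → F) →ₗ[F] (Fin n → F)) (x : Fin n → F) :
      x ᵥ* (LinearMap.toMatrix' f)ᵀ = f x := by
    rw [vecMul_transpose, LinearMap.toMatrix'_mulVec]
  obtain ⟨g, hgt, hgl⟩ := exists_linear (LinearMap.toMatrix' φ.toLinearMap)ᵀ
    (LinearMap.toMatrix' φ.symm.toLinearMap)ᵀ (by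
      rw [← transpose_mul, ← LinearMap.toMatrix'_comp]
      simp)
  have hg (x : Fin n → F) : x ᵥ* lin g = φ x := by
    rw [hgl, key]
    rfl
  have hcomm (x : Fin n → F) : g * hR.rep (φ x) = hS.rep x * g := by
    apply ext_parts
    · rw [tr_mul, tr_mul, hgt, hR.tr_rep, hS.tr_rep, hg]
      simp
    · rw [lin_mul, lin_mul]
      apply Matrix.ext_of_single_vecMul
      intro i
      rw [← vecMul_vecMul, ← vecMul_vecMul, hg, hg, hR.vecMul_lin_rep, hS.vecMul_lin_rep,
        map_add, hφ]
  refine ⟨g, ?_⟩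
  ext s
  simp only [Subgroup.mem_map, MulEquiv.coe_toMonoidHom, MulAut.conj_apply]
  constructor
  · rintro ⟨r, hr, rfl⟩
    rw [hR.eq_rep hr, ← φ.apply_symm_apply (tr r), hcomm, mul_inv_cancel_right]
    exact hS.rep_mem _
  · intro hs
    refine ⟨hR.rep (φ (tr s)), hR.rep_mem _, ?_⟩
    rw [hcomm, mul_inv_cancel_right, ← hS.eq_rep hs]

theorem exists_equiv_of_areConj (hR : IsRegular R) (hS : IsRegular S) (h : AreConj R S) :
    ∃ φ : (Fin n → F) ≃ₗ[F] (Fin n → F), ∀ x y, φ (hS.prod x y) = hR.prod (φ x) (φ y) := by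
  obtain ⟨g₀, hg₀⟩ := h
  -- Correcting the conjugator by an element of `R` makes it fix the origin without changing the
  -- conjugate of `R`, so that its linear part can serve as the isomorphism.
  set g := g₀ * (hR.rep (tr g₀))⁻¹ with hgdef
  have hgt : tr g = 0 := by
    have h1 : tr (g * hR.rep (tr g₀)) = tr g₀ := by rw [hgdef, inv_mul_cancel_right]
    rw [tr_mul, hR.tr_rep, add_eq_left] at h1
    have h2 := congrArg (fun z => z ᵥ* lin (hR.rep (tr g₀))⁻¹) h1
    simpa [vecMul_vecMul, lin_mul_lin_inv] using h2
  have hmem (s : AGL n F) (hs : s ∈ S) : g⁻¹ * s * g ∈ R := by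
    rw [← hg₀] at hs
    obtain ⟨r, hr, rfl⟩ := hs
    have : g⁻¹ * (g₀ * r * g₀⁻¹) * g = hR.rep (tr g₀) * r * (hR.rep (tr g₀))⁻¹ := by
      rw [hgdef]
      group
    rw [MulEquiv.coe_toMonoidHom, MulAut.conj_apply, this]
    exact R.mul_mem (R.mul_mem (hR.rep_mem _) hr) (R.inv_mem (hR.rep_mem _))
  have hcomm (x : Fin n → F) : hS.rep x * g = g * hR.rep (x ᵥ* lin g) := by
    have h1 := hR.eq_rep (hmem _ (hS.rep_mem x))
    have h2 : g * (g⁻¹ * hS.rep x * g) = hS.rep x * g := by group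
    have h3 : tr (g⁻¹ * hS.rep x * g) = x ᵥ* lin g := by
      have h4 := congrArg tr h2
      rw [tr_mul, tr_mul (hS.rep x), hgt, hS.tr_rep] at h4
      simpa using h4
    rw [← h2, h1, h3]
  refine ⟨LinearEquiv.ofLinearMap (Matrix.vecMulLinear (lin g)) (Matrix.vecMulLinear (lin g⁻¹))
    (LinearMap.ext fun x => by simp [vecMul_vecMul, lin_inv_mul_lin])
    (LinearMap.ext fun x => by simp [vecMul_vecMul, lin_mul_lin_inv]), fun x y => ?_⟩
  change hS.prod x y ᵥ* lin g = hR.prod (x ᵥ* lin g) (y ᵥ* lin g)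
  have h1 := congrArg (fun m => x ᵥ* lin m) (hcomm y)
  simp only [lin_mul, ← vecMul_vecMul, hS.vecMul_lin_rep, hR.vecMul_lin_rep, add_vecMul] at h1
  exact add_left_cancel h1

end Regular

/-! ### Subgroups given by explicit families of matrices -/

section OfMatrices

variable {M : (Fin 4 → F) → Matrix (Fin 5) (Fin 5) F}
  {hmul : ∀ x y, ∃ z, M x * M y = M z} {hinv : ∀ x, ∃ y, M x * M y = 1}

theorem isRegular_ofMatrices (h0 : ∀ x i, M x i 0 = if i = 0 then 1 else 0)
    (h1 : ∀ x j, M x 0 (Fin.succ j) = x j) : IsRegular (ofMatrices M hmul hinv) := by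
  intro v
  obtain ⟨w, hw⟩ := hinv v
  obtain ⟨g, hg⟩ := exists_mat_eq (M v) (M w) hw (h0 v)
  refine ⟨g, ⟨⟨v, hg⟩, ?_⟩, ?_⟩
  · rw [row_zero_eq_iff]
    ext j
    rw [tr, hg, h1]
  · rintro r ⟨⟨x, hx⟩, hr⟩
    rw [row_zero_eq_iff] at hr
    have hxv : x = v := by
      ext j
      rw [← hr, tr, hx, h1]
    apply mat_injective
    rw [hx, hxv, hg]

theorem isAbelian_ofMatrices (h : ∀ x y, M x * M y = M y * M x) :
    IsAbelian (ofMatrices M hmul hinv) := by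
  rintro a ⟨x, hx⟩ b ⟨y, hy⟩
  apply mat_injective
  rw [mat_mul, mat_mul, hx, hy, h]

theorem prod_ofMatrices (hR : IsRegular (ofMatrices M hmul hinv))
    (h1 : ∀ x j, M x 0 (Fin.succ j) = x j) (x y : Fin 4 → F) (j : Fin 4) :
    hR.prod x y j = ∑ i : Fin 4, x i * M y i.succ j.succ - x j := by
  obtain ⟨z, hz⟩ := hR.rep_mem y
  have hzy : z = y := by
    rw [← hR.tr_rep y]
    ext j
    rw [tr, hz, h1]
  simp only [IsRegular.prod, Pi.sub_apply, vecMul, dotProduct, lin, hz, hzy]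

end OfMatrices

end Affine

theorem two_eq_zero_iff {F : Type*} [Field F] : (2 : F) = 0 ↔ ringChar F = 2 := by
  constructor
  · intro h
    have hdvd : ringChar F ∣ 2 := (ringChar.spec F 2).mp (by exact_mod_cast h)
    exact ((Nat.dvd_prime Nat.prime_two).mp hdvd).resolve_left CharP.ringChar_ne_one
  · intro h
    have := ringChar.Nat.cast_ringChar (R := F)
    rw [h] at this
    exact_mod_cast this

/-! ### The algebras of the listed subgroups -/

section Models

variable {F : Type*} [Field F]

/-- The product of the algebra attached to `S5`. -/
def prodS5 (x y : Fin 4 → F) : Fin 4 → F :=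
  ![0, x 0 * y 0, x 0 * y 1 + x 1 * y 0, x 0 * y 2 + x 1 * y 1 + x 2 * y 0]

/-- The product of the algebra attached to `S41`. -/
def prodS41 (x y : Fin 4 → F) : Fin 4 → F :=
  ![0, x 0 * y 0, x 0 * y 1 + x 1 * y 0, 0]

/-- The product of the algebra attached to `S32`. -/
def prodS32 (x y : Fin 4 → F) : Fin 4 → F :=
  ![0, x 0 * y 0, 0, x 0 * y 1 + x 1 * y 0 + x 2 * y 2]

/-- The product of the algebra attached to `U1 α β`. -/
def prodU1 (α β : F) (x y : Fin 4 → F) : Fin 4 → F :=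
  ![0, 0, x 0 * y 0 + β * (x 1 * y 1), x 0 * y 1 + x 1 * y 0 + α * (x 1 * y 1)]

/-- The product of the algebra attached to `RR D`. -/
def prodRR (D : Matrix (Fin 3) (Fin 3) F) (x y : Fin 4 → F) : Fin 4 → F :=
  ![0, 0, 0,
    x 0 * (D 0 0 * y 0 + D 0 1 * y 1 + D 0 2 * y 2) +
    x 1 * (D 1 0 * y 0 + D 1 1 * y 1 + D 1 2 * y 2) +
    x 2 * (D 2 0 * y 0 + D 2 1 * y 1 + D 2 2 * y 2)]

/-- The product of the algebra attached to a label. -/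
def Label.prod : Label F → (Fin 4 → F) → (Fin 4 → F) → Fin 4 → F
  | .S5 => prodS5
  | .S41 => prodS41
  | .S32 => prodS32
  | .U1 α β => prodU1 α β
  | .RR D => prodRR D

/-- The algebra `A` is isomorphic to `F ^ 4` with the product of the label `l`. -/
def HasModel (A : Type*) [NonUnitalCommRing A] [Module F A] (l : Label F) : Prop :=
  ∃ φ : (Fin 4 → F) ≃ₗ[F] A, ∀ x y, φ (l.prod x y) = φ x * φ y

end Models

/-! ### Bases and dimension counts in dimension four -/

section Dimension

variable {F A : Type*} [Field F] [AddCommGroup A] [Module F A]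

theorem not_independent_five (hd : Module.finrank F A = 4) (x₀ x₁ x₂ x₃ x₄ : A)
    (h : ∀ c₀ c₁ c₂ c₃ c₄ : F, c₀ • x₀ + c₁ • x₁ + c₂ • x₂ + c₃ • x₃ + c₄ • x₄ = 0 →
      c₀ = 0 ∧ c₁ = 0 ∧ c₂ = 0 ∧ c₃ = 0 ∧ c₄ = 0) : False := by
  have hf : Module.Finite F A := Module.finite_of_finrank_pos (by omega)
  have hli : LinearIndependent F ![x₀, x₁, x₂, x₃, x₄] := by
    refine Fintype.linearIndependent_iff.mpr fun c hc i => ?_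
    rw [Fin.sum_univ_five] at hc
    obtain ⟨h0, h1, h2, h3, h4⟩ := h _ _ _ _ _ hc
    fin_cases i <;> assumption
  have := hli.fintype_card_le_finrank
  rw [hd, Fintype.card_fin] at this
  omega

theorem exists_basis (hd : Module.finrank F A = 4) (x₀ x₁ x₂ x₃ : A)
    (h : ∀ c₀ c₁ c₂ c₃ : F, c₀ • x₀ + c₁ • x₁ + c₂ • x₂ + c₃ • x₃ = 0 →
      c₀ = 0 ∧ c₁ = 0 ∧ c₂ = 0 ∧ c₃ = 0) :
    ∃ φ : (Fin 4 → F) ≃ₗ[F] A,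
      ∀ c, φ c = c 0 • x₀ + c 1 • x₁ + c 2 • x₂ + c 3 • x₃ := by
  have hf : Module.Finite F A := Module.finite_of_finrank_pos (by omega)
  have hli : LinearIndependent F ![x₀, x₁, x₂, x₃] := by
    refine Fintype.linearIndependent_iff.mpr fun c hc i => ?_
    rw [Fin.sum_univ_four] at hc
    obtain ⟨h0, h1, h2, h3⟩ := h _ _ _ _ hc
    fin_cases i <;> assumption
  refine ⟨(basisOfLinearIndependentOfCardEqFinrank hli (by rw [hd, Fintype.card_fin])).equivFun.symm,
    fun c => ?_⟩
  rw [Module.Basis.equivFun_symm_apply, Fin.sum_univ_four]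
  simp only [coe_basisOfLinearIndependentOfCardEqFinrank]
  rfl

theorem exists_independent_of_three (hd : Module.finrank F A = 4) (x₀ x₁ x₂ : A)
    (h : ∀ c₀ c₁ c₂ : F, c₀ • x₀ + c₁ • x₁ + c₂ • x₂ = 0 → c₀ = 0 ∧ c₁ = 0 ∧ c₂ = 0) :
    ∃ y : A, ∀ c₀ c₁ c₂ c₃ : F, c₀ • x₀ + c₁ • x₁ + c₂ • x₂ + c₃ • y = 0 →
      c₀ = 0 ∧ c₁ = 0 ∧ c₂ = 0 ∧ c₃ = 0 := by
  have hf : Module.Finite F A := Module.finite_of_finrank_pos (by omega)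
  have hli : LinearIndependent F ![x₀, x₁, x₂] := by
    refine Fintype.linearIndependent_iff.mpr fun c hc i => ?_
    rw [Fin.sum_univ_three] at hc
    obtain ⟨h0, h1, h2⟩ := h _ _ _ hc
    fin_cases i <;> assumption
  obtain ⟨y, hy⟩ := exists_linearIndependent_cons_of_lt_finrank hli (by omega)
  refine ⟨y, fun c₀ c₁ c₂ c₃ hc => ?_⟩
  have := Fintype.linearIndependent_iff.mp hy ![c₃, c₀, c₁, c₂] (by
    rw [Fin.sum_univ_four, ← hc]
    change c₃ • y + c₀ • x₀ + c₁ • x₁ + c₂ • x₂ = _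
    abel)
  exact ⟨this 1, this 2, this 3, this 0⟩

theorem exists_independent_of_one (hd : Module.finrank F A = 4) (z : A) (hz : z ≠ 0) :
    ∃ x₀ x₁ x₂ : A, ∀ c₀ c₁ c₂ c₃ : F, c₀ • x₀ + c₁ • x₁ + c₂ • x₂ + c₃ • z = 0 →
      c₀ = 0 ∧ c₁ = 0 ∧ c₂ = 0 ∧ c₃ = 0 := by
  have hf : Module.Finite F A := Module.finite_of_finrank_pos (by omega)
  have hli : LinearIndependent F ![z] := by
    refine Fintype.linearIndependent_iff.mpr fun c hc i => ?_
    rw [Fin.sum_univ_one] at hc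
    rw [Subsingleton.elim i 0]
    exact (smul_eq_zero.mp hc).resolve_right hz
  obtain ⟨x₂, h₂⟩ := exists_linearIndependent_cons_of_lt_finrank hli (by omega)
  obtain ⟨x₁, h₁⟩ := exists_linearIndependent_cons_of_lt_finrank h₂ (by omega)
  obtain ⟨x₀, h₀⟩ := exists_linearIndependent_cons_of_lt_finrank h₁ (by omega)
  refine ⟨x₀, x₁, x₂, fun c₀ c₁ c₂ c₃ hc => ?_⟩
  have := Fintype.linearIndependent_iff.mp h₀ ![c₀, c₁, c₂, c₃] (by
    rw [Fin.sum_univ_four]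
    exact hc)
  exact ⟨this 0, this 1, this 2, this 3⟩

theorem eq_smul_of_smul_add_smul_eq_zero {u v : A} {s t : F} (ht : t ≠ 0)
    (h : s • u + t • v = 0) : v = (-(t⁻¹ * s)) • u := by
  rw [eq_neg_of_add_eq_zero_left h |> fun h' => show (-(t⁻¹ * s)) • u = t⁻¹ • t • v by
    rw [neg_smul, mul_smul, h', smul_neg, neg_neg], inv_smul_smul₀ ht]

end Dimension

/-! ### Powers of one element, and algebras with a nonzero cube -/

section Classification

variable {F A : Type*} [Field F] [NonUnitalCommRing A] [Module F A] [IsScalarTower F A A]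
  [SMulCommClass F A A]

omit [SMulCommClass F A A] in
theorem eq_zero_of_smul_add_mul (hJ : ∀ v y : A, y + v * y = 0 → y = 0) {c : F} (hc : c ≠ 0)
    {v y : A} (h : c • y + v * y = 0) : y = 0 := by
  apply hJ (c⁻¹ • v)
  have h2 := congrArg (c⁻¹ • ·) h
  simpa [smul_smul, hc, smul_mul_assoc] using h2

omit [SMulCommClass F A A] in
-- Multiplications have no nonzero eigenvalue: this is the form in which nilpotency is mostly used.
theorem eq_zero_or_eq_zero_of_mul_eq_smul (hJ : ∀ v y : A, y + v * y = 0 → y = 0) {c : F}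
    {v y : A} (h : v * y = c • y) : c = 0 ∨ y = 0 := by
  by_contra! hc
  exact hc.2 (eq_zero_of_smul_add_mul hJ hc.1 (v := -v) (by rw [neg_mul, h, add_neg_cancel]))

omit [SMulCommClass F A A] in
-- If `c₀ ≠ 0`, the left side is `y` multiplied by `c₀` plus an element of the algebra, which acts
-- injectively.
theorem coeff_eq_zero_of_powers (hJ : ∀ v y : A, y + v * y = 0 → y = 0)
    {c₀ c₁ c₂ c₃ c₄ : F} (x y : A) (hy : y ≠ 0)
    (h : c₀ • y + c₁ • (x * y) + c₂ • (x * (x * y)) + c₃ • (x * (x * (x * y))) +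
      c₄ • (x * (x * (x * (x * y)))) = 0) : c₀ = 0 := by
  by_contra hc
  refine hy (eq_zero_of_smul_add_mul hJ hc
    (v := c₁ • x + c₂ • (x * x) + c₃ • (x * (x * x)) + c₄ • (x * (x * (x * x)))) ?_)
  rw [← h]
  simp only [add_mul, smul_mul_assoc, mul_assoc]
  abel

omit [SMulCommClass F A A] in
theorem powers_independent (hJ : ∀ v y : A, y + v * y = 0 → y = 0) (x : A)
    {c₀ c₁ c₂ c₃ c₄ : F}
    (h : c₀ • x + c₁ • (x * x) + c₂ • (x * (x * x)) + c₃ • (x * (x * (x * x))) +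
      c₄ • (x * (x * (x * (x * x)))) = 0) :
    (x ≠ 0 → c₀ = 0) ∧ (x * x ≠ 0 → c₁ = 0) ∧ (x * (x * x) ≠ 0 → c₂ = 0) ∧
    (x * (x * (x * x)) ≠ 0 → c₃ = 0) ∧ (x * (x * (x * (x * x))) ≠ 0 → c₄ = 0) := by
  have h0 : x ≠ 0 → c₀ = 0 := fun hx => coeff_eq_zero_of_powers hJ x x hx h
  have h0' : c₀ • x = 0 := by
    by_cases hx : x = 0
    · rw [hx, smul_zero]
    · rw [h0 hx, zero_smul]
  rw [h0', zero_add] at h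
  have h1 : x * x ≠ 0 → c₁ = 0 := fun hx =>
    coeff_eq_zero_of_powers (c₄ := 0) hJ x (x * x) hx (by simpa using h)
  have h1' : c₁ • (x * x) = 0 := by
    by_cases hx : x * x = 0
    · rw [hx, smul_zero]
    · rw [h1 hx, zero_smul]
  rw [h1', zero_add] at h
  have h2 : x * (x * x) ≠ 0 → c₂ = 0 := fun hx =>
    coeff_eq_zero_of_powers (c₃ := 0) (c₄ := 0) hJ x (x * (x * x)) hx (by simpa using h)
  have h2' : c₂ • (x * (x * x)) = 0 := by
    by_cases hx : x * (x * x) = 0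
    · rw [hx, smul_zero]
    · rw [h2 hx, zero_smul]
  rw [h2', zero_add] at h
  have h3 : x * (x * (x * x)) ≠ 0 → c₃ = 0 := fun hx =>
    coeff_eq_zero_of_powers (c₂ := 0) (c₃ := 0) (c₄ := 0) hJ x (x * (x * (x * x))) hx
      (by simpa using h)
  have h3' : c₃ • (x * (x * (x * x))) = 0 := by
    by_cases hx : x * (x * (x * x)) = 0
    · rw [hx, smul_zero]
    · rw [h3 hx, zero_smul]
  rw [h3', zero_add] at h
  exact ⟨h0, h1, h2, h3, fun hx => (smul_eq_zero.mp h).resolve_right hx⟩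

omit [SMulCommClass F A A] in
theorem fifth_power_eq_zero (hd : Module.finrank F A = 4)
    (hJ : ∀ v y : A, y + v * y = 0 → y = 0) (x : A) : x * (x * (x * (x * x))) = 0 := by
  by_contra h5
  have h4 : x * (x * (x * x)) ≠ 0 := fun h => h5 (by rw [h, mul_zero])
  have h3 : x * (x * x) ≠ 0 := fun h => h4 (by rw [h, mul_zero])
  have h2 : x * x ≠ 0 := fun h => h3 (by rw [h, mul_zero])
  have h1 : x ≠ 0 := fun h => h2 (by rw [h, mul_zero])
  refine not_independent_five (F := F) hd x (x * x) (x * (x * x)) (x * (x * (x * x)))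
    (x * (x * (x * (x * x)))) fun c₀ c₁ c₂ c₃ c₄ hc => ?_
  obtain ⟨k0, k1, k2, k3, k4⟩ := powers_independent hJ x hc
  exact ⟨k0 h1, k1 h2, k2 h3, k3 h4, k4 h5⟩

theorem hasModel_S5 (hd : Module.finrank F A = 4) (hJ : ∀ v y : A, y + v * y = 0 → y = 0)
    (x : A) (h4 : x * (x * (x * x)) ≠ 0) : HasModel A (Label.S5 : Label F) := by
  have h3 : x * (x * x) ≠ 0 := fun h => h4 (by rw [h, mul_zero])
  have h2 : x * x ≠ 0 := fun h => h3 (by rw [h, mul_zero])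
  have h1 : x ≠ 0 := fun h => h2 (by rw [h, mul_zero])
  have h5 := fifth_power_eq_zero hd hJ x
  obtain ⟨φ, hφ⟩ := exists_basis hd x (x * x) (x * (x * x)) (x * (x * (x * x)))
    (fun c₀ c₁ c₂ c₃ hc => by
      obtain ⟨k0, k1, k2, k3, -⟩ := powers_independent (c₀ := c₀) (c₁ := c₁) (c₂ := c₂)
        (c₃ := c₃) (c₄ := 0) hJ x (by rw [zero_smul, add_zero]; exact hc)
      exact ⟨k0 h1, k1 h2, k2 h3, k3 h4⟩)
  refine ⟨φ, fun a b => ?_⟩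
  simp only [hφ, Label.prod, prodS5, add_mul, mul_add, smul_mul_smul_comm, mul_assoc, h5, mul_zero,
    smul_zero, Matrix.cons_val]
  module

/-- The two models with a nonzero cube and all fourth powers zero. -/
theorem hasModel_of_cube_ne_zero (hd : Module.finrank F A = 4)
    (hJ : ∀ v y : A, y + v * y = 0 → y = 0) (x : A) (h3 : x * (x * x) ≠ 0)
    (h4 : x * (x * (x * x)) = 0) :
    HasModel A (Label.S41 : Label F) ∨ HasModel A (Label.S32 : Label F) := by
  have h2 : x * x ≠ 0 := fun h => h3 (by rw [h, mul_zero])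
  have h1 : x ≠ 0 := fun h => h2 (by rw [h, mul_zero])
  obtain ⟨y, hy⟩ := exists_independent_of_three hd x (x * x) (x * (x * x))
    (fun c₀ c₁ c₂ hc => by
      obtain ⟨k0, k1, k2, -, -⟩ := powers_independent (c₀ := c₀) (c₁ := c₁) (c₂ := c₂)
        (c₃ := 0) (c₄ := 0) hJ x
        (by simpa using hc)
      exact ⟨k0 h1, k1 h2, k2 h3⟩)
  obtain ⟨z, hxz, hz⟩ : ∃ z : A, x * z = 0 ∧
      ∀ c₀ c₁ c₂ c₃ : F, c₀ • x + c₁ • (x * x) + c₂ • (x * (x * x)) + c₃ • z = 0 →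
      c₀ = 0 ∧ c₁ = 0 ∧ c₂ = 0 ∧ c₃ = 0 := by
    obtain ⟨φ, hφ⟩ := exists_basis hd _ _ _ _ hy
    obtain ⟨c, hc⟩ := φ.surjective (x * y)
    rw [hφ] at hc
    have hc3 : c 3 = 0 := by
      by_contra h
      -- If `c 3 ≠ 0`, adding suitable multiples of `x`, `x²`, `x³` to `y` gives an eigenvector of
      -- multiplication by `x`; comparing coefficients determines the multiples one after the other.
      have hxy' : x * (y + (c 0 / c 3) • x + ((c 1 + c 0 / c 3) / c 3) • (x * x) +
          ((c 2 + (c 1 + c 0 / c 3) / c 3) / c 3) • (x * (x * x))) =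
          c 3 • (y + (c 0 / c 3) • x + ((c 1 + c 0 / c 3) / c 3) • (x * x) +
          ((c 2 + (c 1 + c 0 / c 3) / c 3) / c 3) • (x * (x * x))) := by
        simp only [mul_add, mul_smul_comm, h4, ← hc, smul_add, smul_smul, mul_div_cancel₀ _ h]
        module
      have := (eq_zero_or_eq_zero_of_mul_eq_smul hJ hxy').resolve_left h
      have := (hy (c 0 / c 3) ((c 1 + c 0 / c 3) / c 3)
        ((c 2 + (c 1 + c 0 / c 3) / c 3) / c 3) 1 (by rw [← this]; module)).2.2.2
      exact one_ne_zero this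
    have hc0 : c 0 = 0 := by
      -- Since `y x³ = x² (x y)`, the cube `x³` is an eigenvector of `y` with eigenvalue `c 0`.
      have : y * (x * (x * x)) = c 0 • (x * (x * x)) := by
        have h : y * (x * (x * x)) = (x * x) * (x * y) := by
          rw [mul_left_comm, mul_left_comm y, ← mul_assoc, mul_comm y]
        rw [h, ← hc, hc3]
        simp only [mul_add, mul_smul_comm, mul_assoc, h4, mul_zero]
        module
      exact (eq_zero_or_eq_zero_of_mul_eq_smul hJ this).resolve_right h3
    refine ⟨y - c 1 • x - c 2 • (x * x), ?_, fun c₀ c₁ c₂ c₃ h => ?_⟩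
    · simp only [mul_sub, mul_smul_comm, ← hc, hc0, hc3]
      module
    · have := hy (c₀ - c₃ * c 1) (c₁ - c₃ * c 2) c₂ c₃ (by rw [← h]; module)
      obtain ⟨k0, k1, k2, k3⟩ := this
      rw [k3, zero_mul, sub_zero] at k0 k1
      exact ⟨k0, k1, k2, k3⟩
  obtain ⟨r, hr⟩ : ∃ r : F, z * z = r • (x * (x * x)) := by
    obtain ⟨φ, hφ⟩ := exists_basis hd _ _ _ _ hz
    obtain ⟨c, hc⟩ := φ.surjective (z * z)
    rw [hφ] at hc
    -- The relation `x z² = 0` kills the coefficients of `x` and `x²` in `z²`; then `z³ = c 3 • z²`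
    -- kills that of `z`.
    have hxzz : (0 : F) • x + c 0 • (x * x) + c 1 • (x * (x * x)) + (0 : F) • z = 0 := by
      have : x * (z * z) = 0 := by rw [← mul_assoc, hxz, zero_mul]
      rw [← this, ← hc]
      simp only [mul_add, mul_smul_comm, h4, hxz]
      module
    obtain ⟨-, hc0, hc1, -⟩ := hz _ _ _ _ hxzz
    have hzzz : z * (z * z) = c 3 • (z * z) := by
      conv_lhs => rw [← hc]
      have : z * x = 0 := by rw [mul_comm, hxz]
      simp only [mul_add, mul_smul_comm, ← mul_assoc, this, zero_mul, smul_zero, zero_add]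
    have hc3 : c 3 = 0 := by
      rcases eq_zero_or_eq_zero_of_mul_eq_smul hJ hzzz with h | h
      · exact h
      · rw [h] at hc
        exact (hz _ _ _ _ hc).2.2.2
    exact ⟨c 2, by rw [← hc, hc0, hc1, hc3]; module⟩
  have hzx : z * x = 0 := by rw [mul_comm, hxz]
  have hzx' (a : A) : z * (x * a) = 0 := by rw [← mul_assoc, hzx, zero_mul]
  by_cases hr0 : r = 0
  · left
    obtain ⟨φ, hφ⟩ := exists_basis hd _ _ _ _ hz
    refine ⟨φ, fun a b => ?_⟩
    rw [hr0, zero_smul] at hr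
    simp only [hφ, Label.prod, prodS41, add_mul, mul_add, smul_mul_smul_comm, mul_assoc, h4, hzx,
      hzx', hxz, hr, mul_zero, smul_zero, Matrix.cons_val]
    module
  · right
    -- With this scaling `(r z)² = r³ x³ = (r x)³`, so the parameter `r` disappears.
    obtain ⟨φ, hφ⟩ := exists_basis hd (r • x) ((r * r) • (x * x)) (r • z)
      ((r * r * r) • (x * (x * x))) (fun c₀ c₁ c₂ c₃ h => by
        obtain ⟨k0, k1, k2, k3⟩ := hz (c₀ * r) (c₁ * (r * r)) (c₃ * (r * r * r)) (c₂ * r)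
          (by rw [← h]; module)
        simp only [mul_eq_zero, hr0, or_false] at k0 k1 k2 k3
        exact ⟨k0, k1, k3, k2⟩)
    refine ⟨φ, fun a b => ?_⟩
    simp only [hφ, Label.prod, prodS32, add_mul, mul_add, smul_mul_smul_comm, mul_assoc, h4, hzx,
      hzx', hxz, hr, mul_zero, smul_zero, Matrix.cons_val, smul_smul]
    module

/-! ### Vanishing cubes force vanishing triple products -/

/-- Polarising `x³ = 0` loses information in small characteristic, so dimension is used instead. If
`a²c ≠ 0`, then `a, c, a², ac, a²c` would be five independent elements: multiplying a relation by
`a²`, `ac`, `a`, `c` in turn isolates its coefficients. -/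
theorem mul_mul_eq_zero_of_cubes_aux (hd : Module.finrank F A = 4)
    (hJ : ∀ v y : A, y + v * y = 0 → y = 0) (hcube : ∀ x : A, x * (x * x) = 0) (a c : A) :
    a * (a * c) = 0 := by
  by_contra ht
  have hp (u : A) : a * (a * (a * u)) = 0 := by
    rw [← mul_assoc a a, ← mul_assoc, mul_assoc a a a, hcube, zero_mul]
  refine not_independent_five (F := F) hd a c (a * a) (a * c) (a * (a * c))
    fun c₀ c₁ c₂ c₃ c₄ h => ?_
  have h1 : c₁ = 0 := by
    have := congrArg (fun u => a * (a * u)) h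
    simp only [mul_add, mul_smul_comm, hp, hcube, mul_zero, smul_zero, zero_add, add_zero] at this
    exact (smul_eq_zero.mp this).resolve_right ht
  subst h1
  have h0 : c₀ = 0 := by
    by_contra h0
    -- Multiplication by `ac` leaves `(c₀ + c₃ c) a²c = 0`, and the factor acts injectively when `c₀
    -- ≠ 0`.
    refine ht (eq_zero_of_smul_add_mul hJ h0 (v := c₃ • c) ?_)
    have := congrArg (fun u => a * c * u) h
    simp only [mul_add, mul_smul_comm, zero_smul, mul_zero, add_zero] at this
    rw [show a * c * a = a * (a * c) by rw [mul_comm],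
      show a * c * (a * a) = 0 by rw [mul_comm a c, mul_assoc, hcube, mul_zero],
      show a * c * (a * c) = c * (a * (a * c)) by rw [mul_comm a c, mul_assoc],
      show a * c * (a * (a * c)) = 0 by rw [mul_comm a c, mul_assoc, mul_comm c a, hp, mul_zero]]
      at this
    rw [smul_mul_assoc, ← this]
    module
  subst h0
  have h3 : c₃ = 0 := by
    have := congrArg (fun u => a * u) h
    simp only [mul_add, mul_smul_comm, hp, hcube, mul_zero, smul_zero, zero_add, add_zero,
      zero_smul] at this
    exact (smul_eq_zero.mp this).resolve_right ht
  subst h3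
  have h2 : c₂ = 0 := by
    by_contra h2
    refine ht (eq_zero_of_smul_add_mul hJ h2 (v := c₄ • c) ?_)
    have := congrArg (fun u => c * u) h
    simp only [mul_add, mul_smul_comm, mul_zero, add_zero, zero_smul, zero_add] at this
    rw [show c * (a * a) = a * (a * c) by rw [mul_left_comm, mul_comm c]] at this
    rw [smul_mul_assoc, ← this]
  subst h2
  simpa [ht] using h

/-- Every product with a repeated factor now vanishes, so `abc ≠ 0` would make `a, b, c, ab, abc`
independent; multiply by `bc`, `ac`, `ab`, `c`. -/
theorem mul_mul_eq_zero_of_cubes (hd : Module.finrank F A = 4)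
    (hJ : ∀ v y : A, y + v * y = 0 → y = 0) (hcube : ∀ x : A, x * (x * x) = 0) (a b c : A) :
    a * (b * c) = 0 := by
  have hsq := mul_mul_eq_zero_of_cubes_aux (F := F) hd hJ hcube
  by_contra ht
  refine not_independent_five (F := F) hd a b c (a * b) (a * (b * c))
    fun c₀ c₁ c₂ c₃ c₄ h => ?_
  have h0 : c₀ = 0 := by
    have := congrArg (fun u => b * (c * u)) h
    simp only [mul_add, mul_smul_comm] at this
    rw [show b * (c * a) = a * (b * c) by rw [mul_comm c, mul_left_comm],
      show b * (c * b) = 0 by rw [mul_comm c, hsq],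
      show b * (c * c) = 0 by rw [mul_comm, mul_assoc, hsq],
      show b * (c * (a * b)) = 0 by rw [mul_comm a, mul_left_comm c, hsq],
      show b * (c * (a * (b * c))) = 0 by
        rw [mul_left_comm a, mul_left_comm c, hsq]] at this
    simpa [ht] using this
  have h1 : c₁ = 0 := by
    have := congrArg (fun u => a * (c * u)) h
    simp only [mul_add, mul_smul_comm] at this
    rw [show a * (c * a) = 0 by rw [mul_comm c, hsq],
      show a * (c * b) = a * (b * c) by rw [mul_comm c],
      show a * (c * c) = 0 by rw [mul_comm, mul_assoc, hsq],
      show a * (c * (a * b)) = 0 by rw [mul_left_comm c, hsq],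
      show a * (c * (a * (b * c))) = 0 by
        rw [mul_left_comm c, hsq]] at this
    simpa [ht] using this
  have h2 : c₂ = 0 := by
    have := congrArg (fun u => a * (b * u)) h
    simp only [mul_add, mul_smul_comm] at this
    rw [show a * (b * a) = 0 by rw [mul_comm b, hsq],
      show a * (b * b) = 0 by rw [mul_comm, mul_assoc, hsq],
      show a * (b * (a * b)) = 0 by rw [mul_left_comm b, hsq],
      show a * (b * (a * (b * c))) = 0 by
        rw [mul_left_comm b, hsq]] at this
    simpa [ht] using this
  subst h0 h1 h2
  have h3 : c₃ = 0 := by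
    have := congrArg (fun u => c * u) h
    simp only [mul_add, mul_smul_comm] at this
    rw [show c * (a * b) = a * (b * c) by rw [mul_left_comm, mul_comm c],
      show c * (a * (b * c)) = 0 by
        rw [mul_comm b, mul_left_comm a, hsq]] at this
    simpa [ht] using this
  subst h3
  simpa [ht] using h

/-! ### Algebras with independent products `e₁²` and `e₁e₂` -/

/-- A pair whose square and product are independent, with the remaining square expressed by
them. -/
structure IsUPair (e₁ e₂ : A) (α β : F) : Prop where
  indep : ∀ s t : F, s • (e₁ * e₁) + t • (e₁ * e₂) = 0 → s = 0 ∧ t = 0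
  sq : e₂ * e₂ = β • (e₁ * e₁) + α • (e₁ * e₂)

omit [IsScalarTower F A A] in
theorem independent_of_pair (h3 : ∀ a b c : A, a * (b * c) = 0) {e₁ e₂ : A}
    (h : ∀ s t : F, s • (e₁ * e₁) + t • (e₁ * e₂) = 0 → s = 0 ∧ t = 0) (c₀ c₁ c₂ c₃ : F)
    (hc : c₀ • e₁ + c₁ • e₂ + c₂ • (e₁ * e₁) + c₃ • (e₁ * e₂) = 0) :
    c₀ = 0 ∧ c₁ = 0 ∧ c₂ = 0 ∧ c₃ = 0 := by
  have := congrArg (fun u => e₁ * u) hc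
  simp only [mul_add, mul_smul_comm, h3, mul_zero, smul_zero, add_zero] at this
  obtain ⟨rfl, rfl⟩ := h _ _ this
  exact ⟨rfl, rfl, h _ _ (by simpa using hc)⟩

omit [IsScalarTower F A A] in
theorem exists_isUPair (hd : Module.finrank F A = 4) (h3 : ∀ a b c : A, a * (b * c) = 0)
    {e₁ e₂ : A} (h : ∀ s t : F, s • (e₁ * e₁) + t • (e₁ * e₂) = 0 → s = 0 ∧ t = 0) :
    ∃ α β : F, IsUPair e₁ e₂ α β := by
  obtain ⟨φ, hφ⟩ := exists_basis hd _ _ _ _ (independent_of_pair h3 h)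
  obtain ⟨c, hc⟩ := φ.surjective (e₂ * e₂)
  rw [hφ] at hc
  -- Multiplying by `e₁` removes the part of `e₂²` outside the span of `e₁²` and `e₁e₂`, because
  -- triple products vanish.
  have := congrArg (fun u => e₁ * u) hc
  simp only [mul_add, mul_smul_comm, h3, smul_zero, add_zero] at this
  obtain ⟨h0, h1⟩ := h _ _ this
  exact ⟨c 3, c 2, h, by rw [← hc, h0, h1]; module⟩

theorem IsUPair.hasModel (hd : Module.finrank F A = 4) (h3 : ∀ a b c : A, a * (b * c) = 0)
    {e₁ e₂ : A} {α β : F} (h : IsUPair e₁ e₂ α β) : HasModel A (Label.U1 α β) := by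
  obtain ⟨φ, hφ⟩ := exists_basis hd _ _ _ _ (independent_of_pair h3 h.indep)
  have h3' (a b c : A) : a * b * c = 0 := by rw [mul_assoc, h3]
  refine ⟨φ, fun a b => ?_⟩
  simp only [hφ, Label.prod, prodU1, add_mul, mul_add, smul_mul_smul_comm, h3, h3',
    smul_zero, Matrix.cons_val, h.sq, mul_comm e₂ e₁]
  module

/-- Substitution `e₁ ↦ p e₁ + q e₂`, `e₂ ↦ r e₁ + s e₂`. The determinant condition keeps the new
square and product independent; the two equations compare coordinates in the new relation. -/
theorem IsUPair.change {e₁ e₂ : A} {α β : F} (h : IsUPair e₁ e₂ α β) (α' β' p q r s : F)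
    (hdet : (p ^ 2 + β * q ^ 2) * (p * s + q * r + α * (q * s)) ≠
      (2 * (p * q) + α * q ^ 2) * (p * r + β * (q * s)))
    (h1 : r ^ 2 + β * s ^ 2 = β' * (p ^ 2 + β * q ^ 2) + α' * (p * r + β * (q * s)))
    (h2 : 2 * (r * s) + α * s ^ 2 =
      β' * (2 * (p * q) + α * q ^ 2) + α' * (p * s + q * r + α * (q * s))) :
    IsUPair (p • e₁ + q • e₂) (r • e₁ + s • e₂) α' β' := by
  have hmul (a b c d : F) : (a • e₁ + b • e₂) * (c • e₁ + d • e₂) =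
      (a * c + β * (b * d)) • (e₁ * e₁) + (a * d + b * c + α * (b * d)) • (e₁ * e₂) := by
    simp only [add_mul, mul_add, smul_mul_smul_comm, h.sq, mul_comm e₂ e₁]
    module
  constructor
  · intro x y hxy
    rw [hmul, hmul] at hxy
    obtain ⟨k1, k2⟩ := h.indep (x * (p * p + β * (q * q)) + y * (p * r + β * (q * s)))
      (x * (p * q + q * p + α * (q * q)) + y * (p * s + q * r + α * (q * s)))
      (by rw [← hxy]; module)
    have hx : x * ((p ^ 2 + β * q ^ 2) * (p * s + q * r + α * (q * s)) -
      (2 * (p * q) + α * q ^ 2) * (p * r + β * (q * s))) = 0 := by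
      linear_combination (p * s + q * r + α * (q * s)) * k1 - (p * r + β * (q * s)) * k2
    have hy : y * ((p ^ 2 + β * q ^ 2) * (p * s + q * r + α * (q * s)) -
      (2 * (p * q) + α * q ^ 2) * (p * r + β * (q * s))) = 0 := by
      linear_combination (p ^ 2 + β * q ^ 2) * k2 - (2 * (p * q) + α * q ^ 2) * k1
    exact ⟨(mul_eq_zero.mp hx).resolve_right (sub_ne_zero.mpr hdet),
      (mul_eq_zero.mp hy).resolve_right (sub_ne_zero.mpr hdet)⟩
  · rw [hmul, hmul, hmul]
    have k1 : r * r + β * (s * s) = β' * (p * p + β * (q * q)) + α' * (p * r + β * (q * s)) := by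
      linear_combination h1
    have k2 : r * s + s * r + α * (s * s) =
        β' * (p * q + q * p + α * (q * q)) + α' * (p * s + q * r + α * (q * s)) := by
      linear_combination h2
    rw [k1, k2]
    module

/-! ### Algebras whose products lie on one line -/

/-- Subtracting multiples of `x` reduces to factors annihilated by `x`. For such `y`, `z` the
hypothesis is applied to `x + y`, whose square is `x² + y²`, or to `y` itself if that square
vanishes. -/
theorem products_in_line_of_sq_ne_zero {x : A} (hx : x * x ≠ 0)
    (H : ∀ x y : A, x * x ≠ 0 → ∃ c : F, x * y = c • (x * x)) (y z : A) :
    ∃ c : F, y * z = c • (x * x) := by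
  have key (y z : A) (hy : x * y = 0) (hz : x * z = 0) : ∃ c : F, y * z = c • (x * x) := by
    have hyx : y * x = 0 := by rw [mul_comm, hy]
    have hsum : (x + y) * (x + y) = x * x + y * y := by
      rw [add_mul, mul_add, mul_add, hy, hyx]
      simp
    by_cases h : x * x + y * y = 0
    · have hyy : y * y = -(x * x) := by rw [eq_neg_iff_add_eq_zero, add_comm, h]
      obtain ⟨c, hc⟩ := H y z (by rw [hyy, neg_ne_zero]; exact hx)
      exact ⟨-c, by rw [hc, hyy, smul_neg, neg_smul]⟩
    · obtain ⟨m, hm⟩ := H (x + y) z (by rw [hsum]; exact h)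
      obtain ⟨k, hk⟩ := H (x + y) y (by rw [hsum]; exact h)
      rw [hsum, add_mul, hz, zero_add] at hm
      rw [hsum, add_mul, hy, zero_add] at hk
      -- From `y² = k (x² + y²)`; here `k = 1` would give `x² = 0`, so `y²` is a multiple of `x²`.
      have hk1 : (1 - k) • (y * y) = k • (x * x) := by
        rw [sub_smul, one_smul, sub_eq_iff_eq_add, ← smul_add, ← hk]
      have hk0 : 1 - k ≠ 0 := by
        intro h0
        have : k = 1 := (sub_eq_zero.mp h0).symm
        rw [h0, this, zero_smul, one_smul] at hk1
        exact hx hk1.symm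
      refine ⟨m * (1 + (1 - k)⁻¹ * k), ?_⟩
      rw [← eq_inv_smul_iff₀ hk0] at hk1
      rw [hm, hk1]
      module
  obtain ⟨a, ha⟩ := H x y hx
  obtain ⟨b, hb⟩ := H x z hx
  obtain ⟨c, hc⟩ := key (y - a • x) (z - b • x) (by rw [mul_sub, ha, mul_smul_comm, sub_self])
    (by rw [mul_sub, hb, mul_smul_comm, sub_self])
  refine ⟨c + a * b, ?_⟩
  rw [mul_comm] at ha
  rw [sub_mul, mul_sub, mul_sub, mul_smul_comm, ha, smul_mul_smul_comm, smul_mul_assoc, hb] at hc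
  rw [add_smul, ← hc]
  module

theorem products_in_line_of_sq_eq_zero (hd : Module.finrank F A = 4)
    (h3 : ∀ a b c : A, a * (b * c) = 0) (hsq : ∀ x : A, x * x = 0) {a b : A} (hab : a * b ≠ 0)
    (c d : A) : ∃ k : F, c * d = k • (a * b) := by
  have key (a b c : A) (hab : a * b ≠ 0) : ∃ k : F, a * c = k • (a * b) := by
    by_contra! hc
    have hind (s t : F) (h : s • (a * b) + t • (a * c) = 0) : s = 0 ∧ t = 0 := by
      have ht : t = 0 := by
        by_contra ht
        exact hc _ (eq_smul_of_smul_add_smul_eq_zero ht h)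
      subst ht
      rw [zero_smul, add_zero] at h
      exact ⟨(smul_eq_zero.mp h).resolve_right hab, rfl⟩
    -- Multiplying a relation by `a` removes `b` and `c`, and multiplying by `b` then removes `a`.
    refine not_independent_five (F := F) hd a b c (a * b) (a * c) fun c₀ c₁ c₂ c₃ c₄ h => ?_
    have h' := congrArg (fun u => a * u) h
    simp only [mul_add, mul_smul_comm, h3, hsq, mul_zero, smul_zero, add_zero, zero_add] at h'
    obtain ⟨rfl, rfl⟩ := hind _ _ h'
    have h'' := congrArg (fun u => u * b) h
    simp only [add_mul, smul_mul_assoc, mul_assoc, mul_comm c b, h3, zero_smul, smul_zero,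
      add_zero, zero_mul] at h''
    have h0 := (smul_eq_zero.mp h'').resolve_right hab
    subst h0
    obtain ⟨rfl, rfl⟩ := hind c₃ c₄ (by rw [← h]; module)
    simp
  have key2 (a b c d : A) (hab : a * b ≠ 0) (had : a * d ≠ 0) : ∃ k : F, c * d = k • (a * b) := by
    obtain ⟨k, hk⟩ := key d a c (by rwa [mul_comm])
    obtain ⟨m, hm⟩ := key a b d hab
    exact ⟨k * m, by rw [mul_comm, hk, mul_comm, hm, smul_smul]⟩
  by_cases had : a * d = 0
  · by_cases hbd : b * d = 0
    -- When `d` annihilates both `a` and `b`, replacing `b` by `b + d` leaves `a b` unchanged, and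
    -- `d c` is the difference of `(b + d) c` and `b c`.
    · have hz : (b + d) * a = a * b := by rw [add_mul, mul_comm d, had, add_zero, mul_comm]
      obtain ⟨k, hk⟩ := key (b + d) a c (by rwa [hz])
      obtain ⟨m, hm⟩ := key b a c (by rwa [mul_comm])
      refine ⟨k - m, ?_⟩
      rw [hz, add_mul, hm, mul_comm b] at hk
      rw [mul_comm, sub_smul, ← hk]
      abel
    · rw [mul_comm a]
      exact key2 b a c d (by rwa [mul_comm]) hbd
  · exact key2 a b c d hab had

theorem exists_line_of_not_pair (hd : Module.finrank F A = 4)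
    (h3 : ∀ a b c : A, a * (b * c) = 0)
    (H : ¬ ∃ e₁ e₂ : A, ∀ s t : F, s • (e₁ * e₁) + t • (e₁ * e₂) = 0 → s = 0 ∧ t = 0) :
    ∃ z : A, z ≠ 0 ∧ (∀ x, x * z = 0) ∧ ∀ x y : A, ∃ c : F, x * y = c • z := by
  have H' (x y : A) (hx : x * x ≠ 0) : ∃ c : F, x * y = c • (x * x) := by
    by_contra! hc
    refine H ⟨x, y, fun s t h => ?_⟩
    have ht : t = 0 := by
      by_contra ht
      exact hc _ (eq_smul_of_smul_add_smul_eq_zero ht h)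
    subst ht
    rw [zero_smul, add_zero] at h
    exact ⟨(smul_eq_zero.mp h).resolve_right hx, rfl⟩
  by_cases hsq : ∀ x : A, x * x = 0
  · by_cases h0 : ∀ x y : A, x * y = 0
    · have : Nontrivial A := Module.nontrivial_of_finrank_pos (R := F) (by omega)
      obtain ⟨z, hz⟩ := exists_ne (0 : A)
      exact ⟨z, hz, fun x => h0 x z, fun x y => ⟨0, by rw [h0, zero_smul]⟩⟩
    · push Not at h0
      obtain ⟨a, b, hab⟩ := h0
      exact ⟨a * b, hab, fun x => h3 x a b, products_in_line_of_sq_eq_zero hd h3 hsq hab⟩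
  · push Not at hsq
    obtain ⟨x, hx⟩ := hsq
    exact ⟨x * x, hx, fun y => h3 y x x, products_in_line_of_sq_ne_zero hx H'⟩

theorem exists_hasModel_RR (hd : Module.finrank F A = 4) {z : A} (hz : z ≠ 0)
    (hxz : ∀ x, x * z = 0) (H : ∀ x y : A, ∃ c : F, x * y = c • z) :
    ∃ D : Matrix (Fin 3) (Fin 3) F, D.IsSymm ∧ HasModel A (Label.RR D) := by
  obtain ⟨x₀, x₁, x₂, hx⟩ := exists_independent_of_one (F := F) hd z hz
  choose m hm using H
  have hzx (x : A) : z * x = 0 := by rw [mul_comm, hxz]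
  obtain ⟨φ, hφ⟩ := exists_basis hd _ _ _ _ hx
  -- The Gram matrix of the product, with values read as multiples of `z`.
  refine ⟨Matrix.of fun i j => m (![x₀, x₁, x₂] i) (![x₀, x₁, x₂] j), ?_, φ, fun a b => ?_⟩
  · ext i j
    apply smul_left_injective F hz
    simp only [Matrix.transpose_apply, Matrix.of_apply]
    rw [← hm, ← hm, mul_comm]
  · simp only [hφ, Label.prod, prodRR, add_mul, mul_add, smul_mul_smul_comm, hxz, hzx,
      smul_zero, Matrix.cons_val, hm x₀, hm x₁, hm x₂, Matrix.of_apply]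
    module

omit [IsScalarTower F A A] [SMulCommClass F A A] in
theorem HasModel.congr_RR {D T : Matrix (Fin 3) (Fin 3) F} (h : HasModel A (Label.RR D))
    (hDT : ProjCongruent D T) : HasModel A (Label.RR T) := by
  obtain ⟨φ, hφ⟩ := h
  obtain ⟨c, hc, P, hP, hPD⟩ := hDT
  obtain ⟨u, rfl⟩ := hP
  let f (M : Matrix (Fin 3) (Fin 3) F) (k : F) : (Fin 4 → F) →ₗ[F] (Fin 4 → F) :=
    { toFun := fun x => ![x 0 * M 0 0 + x 1 * M 1 0 + x 2 * M 2 0,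
        x 0 * M 0 1 + x 1 * M 1 1 + x 2 * M 2 1, x 0 * M 0 2 + x 1 * M 1 2 + x 2 * M 2 2, k * x 3]
      map_add' := fun x y => by
        ext i
        fin_cases i <;> simp <;> ring
      map_smul' := fun a x => by
        ext i
        fin_cases i <;> simp <;> ring }
  have hf (M N : Matrix (Fin 3) (Fin 3) F) (k l : F) (h : N * M = 1) (hkl : k * l = 1) :
      f M k ∘ₗ f N l = LinearMap.id := by
    have hNM (i j : Fin 3) : N i 0 * M 0 j + N i 1 * M 1 j + N i 2 * M 2 j =
        (1 : Matrix (Fin 3) (Fin 3) F) i j := by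
      rw [← h, Matrix.mul_apply, Fin.sum_univ_three]
    have hcomp (x : Fin 4 → F) : f M k (f N l x) = x := by
      ext i
      fin_cases i
      · simp only [f, LinearMap.coe_mk, AddHom.coe_mk, Matrix.cons_val, Fin.zero_eta]
        have h0 := hNM 0 0
        have h1 := hNM 1 0
        have h2 := hNM 2 0
        simp at h0 h1 h2
        linear_combination x 0 * h0 + x 1 * h1 + x 2 * h2
      · simp only [f, LinearMap.coe_mk, AddHom.coe_mk, Matrix.cons_val, Fin.mk_one]
        have h0 := hNM 0 1
        have h1 := hNM 1 1
        have h2 := hNM 2 1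
        simp at h0 h1 h2
        linear_combination x 0 * h0 + x 1 * h1 + x 2 * h2
      · simp only [f, LinearMap.coe_mk, AddHom.coe_mk, Matrix.cons_val, Fin.reduceFinMk]
        have h0 := hNM 0 2
        have h1 := hNM 1 2
        have h2 := hNM 2 2
        simp at h0 h1 h2
        linear_combination x 0 * h0 + x 1 * h1 + x 2 * h2
      · simp only [f, LinearMap.coe_mk, AddHom.coe_mk, Matrix.cons_val, Fin.reduceFinMk]
        linear_combination x 3 * hkl
    exact LinearMap.ext hcomp
  -- Apply `P` to the first three coordinates and scale the last by `c`; `P D Pᵀ = c T` is then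
  -- multiplicativity.
  let ψ : (Fin 4 → F) ≃ₗ[F] (Fin 4 → F) := LinearEquiv.ofLinearMap (f u.val c) (f u⁻¹.val c⁻¹)
    (hf _ _ _ _ (by simp) (by simp [hc])) (hf _ _ _ _ (by simp) (by simp [hc]))
  have hent (i j : Fin 3) : (u.val i 0 * D 0 0 + u.val i 1 * D 1 0 + u.val i 2 * D 2 0) * u.val j 0 +
      (u.val i 0 * D 0 1 + u.val i 1 * D 1 1 + u.val i 2 * D 2 1) * u.val j 1 +
      (u.val i 0 * D 0 2 + u.val i 1 * D 1 2 + u.val i 2 * D 2 2) * u.val j 2 = c * T i j := by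
    have := congrFun (congrFun hPD i) j
    simpa only [Matrix.mul_apply, Fin.sum_univ_three, Matrix.transpose_apply, Matrix.smul_apply,
      smul_eq_mul] using this
  refine ⟨ψ.trans φ, fun x y => ?_⟩
  rw [LinearEquiv.trans_apply, LinearEquiv.trans_apply, LinearEquiv.trans_apply, ← hφ]
  congr 1
  change f u.val c (prodRR T x y) = prodRR D (f u.val c x) (f u.val c y)
  ext i
  fin_cases i
  · simp [f, prodRR]
  · simp [f, prodRR]
  · simp [f, prodRR]
  · simp only [f, prodRR, LinearMap.coe_mk, AddHom.coe_mk, Matrix.cons_val, Fin.reduceFinMk]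
    linear_combination -(x 0 * y 0 * hent 0 0 + x 0 * y 1 * hent 0 1 + x 0 * y 2 * hent 0 2 +
      x 1 * y 0 * hent 1 0 + x 1 * y 1 * hent 1 1 + x 1 * y 2 * hent 1 2 +
      x 2 * y 0 * hent 2 0 + x 2 * y 1 * hent 2 1 + x 2 * y 2 * hent 2 2)

/-! ### Normal forms of the relation `e₂² = β e₁² + α e₁e₂` -/

theorem exists_listed_U1 {Q B C : Set F} (P : Set (Matrix (Fin 3) (Fin 3) F))
    (hQ : IsSquareTransversal Q)
    (hB : ringChar F = 2 → IsArtinSchreierTransversal B)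
    (hC : ringChar F = 2 → IsRepSet Q Star C) {e₁ e₂ : A} {α β : F} (h : IsUPair e₁ e₂ α β) :
    ∃ (e e' : A) (α' β' : F), IsUPair e e' α' β' ∧ (Label.U1 α' β').Listed Q B C P := by
  have hscale {e₁ e₂ : A} {β : F} (hβ : β ≠ 0) (h : IsUPair e₁ e₂ 0 β) :
      ∃ (e e' : A) (q : F), q ∈ Q ∧ IsUPair e e' 0 q := by
    obtain ⟨q, ⟨hq, w, hw, hβq⟩, -⟩ := hQ.2 β hβ
    refine ⟨_, _, q, hq, h.change 0 q 1 0 0 w⁻¹ (by simp [hw]) ?_ (by simp)⟩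
    rw [hβq]
    field_simp
    ring
  by_cases h2 : ringChar F = 2
  · have htwo : (2 : F) = 0 := two_eq_zero_iff.mpr h2
    by_cases hα : α = 0
    · subst hα
      obtain ⟨e, e', q, hq, hu⟩ : ∃ (e e' : A) (q : F), q ∈ Q ∧ IsUPair e e' 0 q := by
        by_cases hβ : β = 0
        · subst hβ
          -- In characteristic two `(e₁ + e₂)² = e₁² + e₂²`, so replacing `e₂` by `e₁ + e₂` turns `β
          -- = 0` into `β = 1`.
          exact hscale one_ne_zero (h.change 0 1 1 0 1 1 (by simp) (by ring) (by simp [htwo]))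
        · exact hscale hβ h
      obtain ⟨t, ⟨ht, x₁, x₂, x₃, x₄, hdet, hden, hst⟩, -⟩ := (hC h2).2 q hq
      refine ⟨_, _, 0, t, hu.change 0 t x₃ x₄ x₁ x₂ ?_ ?_ (by simp [htwo]),
        Or.inr (Or.inl ⟨h2, rfl, ht⟩)⟩
      · rw [htwo]
        simp only [zero_mul, add_zero]
        refine mul_ne_zero (by rwa [mul_comm q]) fun h0 => hdet ?_
        linear_combination h0 - x₂ * x₃ * htwo
      · rw [hst]
        rw [mul_comm q, mul_comm q, div_mul_cancel₀ _ hden]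
        ring
    -- Scaling `e₂` makes `α = 1`; then `e₂ ↦ e₂ + l e₁` changes the other parameter by `l² + l`.
    · have h1 := h.change 1 (β / α ^ 2) 1 0 0 α⁻¹ (by simp [hα]) (by field_simp; ring)
        (by field_simp; ring)
      obtain ⟨t, ⟨ht, l, hl⟩, -⟩ := (hB h2).2 (β / α ^ 2) trivial
      refine ⟨_, _, 1, t, h1.change 1 t 1 0 l 1 (by simp) ?_ ?_,
        Or.inr (Or.inr ⟨h2, rfl, ht⟩)⟩
      · linear_combination hl + l ^ 2 * htwo
      · linear_combination l * htwo
  · have htwo : (2 : F) ≠ 0 := fun h0 => h2 (two_eq_zero_iff.mp h0)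
    -- Completing the square removes `α`.
    have h1 := h.change 0 (β + (α / 2) ^ 2) 1 0 (-(α / 2)) 1 (by simp) (by field_simp; ring)
      (by field_simp; ring)
    by_cases hβ : β + (α / 2) ^ 2 = 0
    · rw [hβ] at h1
      exact ⟨_, _, 0, 0, h1, Or.inl ⟨h2, rfl, Or.inl rfl⟩⟩
    · obtain ⟨e, e', q, hq, hu⟩ := hscale hβ h1
      exact ⟨e, e', 0, q, hu, Or.inl ⟨h2, rfl, Or.inr hq⟩⟩

theorem exists_listed_model (hd : Module.finrank F A = 4)
    (hJ : ∀ v y : A, y + v * y = 0 → y = 0)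
    {Q B C : Set F} {P : Set (Matrix (Fin 3) (Fin 3) F)}
    (hQ : IsSquareTransversal Q)
    (hB : ringChar F = 2 → IsArtinSchreierTransversal B)
    (hC : ringChar F = 2 → IsRepSet Q Star C)
    (hP : IsSymmRepSet P) : ∃ l : Label F, l.Listed Q B C P ∧ HasModel A l := by
  by_cases h4 : ∃ x : A, x * (x * (x * x)) ≠ 0
  · obtain ⟨x, hx⟩ := h4
    exact ⟨.S5, trivial, hasModel_S5 hd hJ x hx⟩
  push Not at h4
  by_cases h3 : ∃ x : A, x * (x * x) ≠ 0
  · obtain ⟨x, hx⟩ := h3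
    rcases hasModel_of_cube_ne_zero (F := F) hd hJ x hx (h4 x) with h | h
    · exact ⟨.S41, trivial, h⟩
    · exact ⟨.S32, trivial, h⟩
  push Not at h3
  have h3' := mul_mul_eq_zero_of_cubes (F := F) hd hJ h3
  by_cases hU : ∃ e₁ e₂ : A, ∀ s t : F, s • (e₁ * e₁) + t • (e₁ * e₂) = 0 → s = 0 ∧ t = 0
  · obtain ⟨e₁, e₂, he⟩ := hU
    obtain ⟨α, β, h⟩ := exists_isUPair hd h3' he
    obtain ⟨e, e', α', β', h', hl⟩ := exists_listed_U1 P hQ hB hC h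
    exact ⟨_, hl, h'.hasModel hd h3'⟩
  · obtain ⟨z, hz, hxz, hline⟩ := exists_line_of_not_pair hd h3' hU
    obtain ⟨D, hD, hm⟩ := exists_hasModel_RR hd hz hxz hline
    obtain ⟨T, ⟨hT, hDT⟩, -⟩ := hP.2 D hD
    exact ⟨.RR T, hT, hm.congr_RR hDT⟩

end Classification
-- The listed subgroups: regularity, commutativity and invariants
section Separation

variable {F : Type*} [Field F]

/-- The family of matrices defining the group of a label. -/
def Label.matrices : Label F → (Fin 4 → F) → Matrix (Fin 5) (Fin 5) F
  | .S5 => matS5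
  | .S41 => matS41
  | .S32 => matS32
  | .U1 α β => matU1 α β
  | .RR D => matR D

/-- A uniform presentation, so that regularity, the product and commutativity are treated for all
labels at once. -/
theorem Label.group_eq_ofMatrices (l : Label F) :
    ∃ hmul hinv, l.group = ofMatrices l.matrices hmul hinv := by
  cases l with
  | S5 =>
    rw [group, AGL.S5]
    exact ⟨_, _, rfl⟩
  | S41 =>
    rw [group, AGL.S41]
    exact ⟨_, _, rfl⟩
  | S32 =>
    rw [group, AGL.S32]
    exact ⟨_, _, rfl⟩
  | U1 α β =>
    rw [group, AGL.U1]
    exact ⟨_, _, rfl⟩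
  | RR D =>
    rw [group, AGL.RR]
    exact ⟨_, _, rfl⟩

theorem Label.matrices_col_zero (l : Label F) (x : Fin 4 → F) (i : Fin 5) :
    l.matrices x i 0 = if i = 0 then 1 else 0 := by
  cases l <;> fin_cases i <;> rfl

theorem Label.matrices_row_zero (l : Label F) (x : Fin 4 → F) (j : Fin 4) :
    l.matrices x 0 (Fin.succ j) = x j := by
  cases l <;> fin_cases j <;> rfl

theorem Label.sum_matrices (l : Label F) (x y : Fin 4 → F) (j : Fin 4) :
    ∑ i : Fin 4, x i * l.matrices y i.succ j.succ - x j = l.prod x y j := by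
  cases l with
  | S5 => fin_cases j <;> simp [matrices, matS5, Fin.sum_univ_four, prod, prodS5]
  | S41 => fin_cases j <;> simp [matrices, matS41, Fin.sum_univ_four, prod, prodS41]
  | S32 => fin_cases j <;> simp [matrices, matS32, Fin.sum_univ_four, prod, prodS32]
  | U1 α β => fin_cases j <;> simp [matrices, matU1, Fin.sum_univ_four, prod, prodU1] <;> ring
  | RR D => fin_cases j <;> simp [matrices, matR, Fin.sum_univ_four, prod, prodRR]

theorem Label.isRegular_and_prod (l : Label F) :
    ∃ h : IsRegular l.group, ∀ x y, h.prod x y = l.prod x y := by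
  obtain ⟨hmul, hinv, h⟩ := l.group_eq_ofMatrices
  rw [h]
  refine ⟨isRegular_ofMatrices l.matrices_col_zero l.matrices_row_zero, fun x y => ?_⟩
  ext j
  rw [prod_ofMatrices _ l.matrices_row_zero, l.sum_matrices]

theorem Label.matrices_mul_comm {Q B C : Set F} {P : Set (Matrix (Fin 3) (Fin 3) F)}
    (hP : IsSymmRepSet P) (l : Label F) (hl : l.Listed Q B C P) (x y : Fin 4 → F) :
    l.matrices x * l.matrices y = l.matrices y * l.matrices x := by
  cases l with
  | S5 =>
    simp [matrices, matS5]
    repeat' apply And.intro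
    all_goals ring
  | S41 =>
    simp [matrices, matS41]
    repeat' apply And.intro
    all_goals ring
  | S32 =>
    simp [matrices, matS32]
    repeat' apply And.intro
    all_goals ring
  | U1 α β =>
    simp [matrices, matU1]
    repeat' apply And.intro
    all_goals ring
  | RR D =>
    have hD : D.IsSymm := hP.1 hl
    have h10 := hD.apply 0 1
    have h20 := hD.apply 0 2
    have h21 := hD.apply 1 2
    simp [matrices, matR, h10, h20, h21]
    repeat' apply And.intro
    all_goals ring

theorem Label.isAbelian {Q B C : Set F} {P : Set (Matrix (Fin 3) (Fin 3) F)}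
    (hP : IsSymmRepSet P) (l : Label F) (hl : l.Listed Q B C P) : IsAbelian l.group := by
  obtain ⟨hmul, hinv, h⟩ := l.group_eq_ofMatrices
  rw [h]
  exact isAbelian_ofMatrices (l.matrices_mul_comm hP hl)

/-- The algebras of two labels are isomorphic. -/
def Label.Iso (l m : Label F) : Prop :=
  ∃ φ : (Fin 4 → F) ≃ₗ[F] (Fin 4 → F), ∀ x y, φ (l.prod x y) = m.prod (φ x) (φ y)

theorem Label.Iso.symm {l m : Label F} (h : l.Iso m) : m.Iso l := by
  obtain ⟨φ, hφ⟩ := h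
  exact ⟨φ.symm, fun x y => by
    apply φ.injective
    rw [hφ]
    simp⟩

theorem Label.iso_of_areConj {l m : Label F} (h : AreConj l.group m.group) : l.Iso m := by
  obtain ⟨hl, hlp⟩ := l.isRegular_and_prod
  obtain ⟨hm, hmp⟩ := m.isRegular_and_prod
  obtain ⟨φ, hφ⟩ := exists_equiv_of_areConj hl hm h
  exact Label.Iso.symm ⟨φ, fun x y => by rw [← hmp, ← hlp, hφ]⟩

/-- Some fourth power is nonzero. -/
def Label.HasFourth (l : Label F) : Prop := ∃ x, l.prod x (l.prod x (l.prod x x)) ≠ 0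

/-- Some cube is nonzero. -/
def Label.HasCube (l : Label F) : Prop := ∃ x, l.prod x (l.prod x x) ≠ 0

/-- Every annihilating element is a product. -/
def Label.AnnProd (l : Label F) : Prop := ∀ x, (∀ y, l.prod x y = 0) → ∃ a b, l.prod a b = x

/-- All products lie on one line. -/
def Label.InLine (l : Label F) : Prop := ∃ z : Fin 4 → F, ∀ x y, ∃ c : F, l.prod x y = c • z

theorem Label.Iso.hasFourth {l m : Label F} (h : l.Iso m) (hl : l.HasFourth) : m.HasFourth := by
  obtain ⟨φ, hφ⟩ := h
  obtain ⟨x, hx⟩ := hl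
  refine ⟨φ x, ?_⟩
  rwa [← hφ, ← hφ, ← hφ, Ne, map_eq_zero_iff φ φ.injective]

theorem Label.Iso.hasCube {l m : Label F} (h : l.Iso m) (hl : l.HasCube) : m.HasCube := by
  obtain ⟨φ, hφ⟩ := h
  obtain ⟨x, hx⟩ := hl
  refine ⟨φ x, ?_⟩
  rwa [← hφ, ← hφ, Ne, map_eq_zero_iff φ φ.injective]

theorem Label.Iso.annProd {l m : Label F} (h : l.Iso m) (hl : m.AnnProd) : l.AnnProd := by
  obtain ⟨φ, hφ⟩ := h
  intro x hx
  obtain ⟨a, b, hab⟩ := hl (φ x) (fun y => by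
    rw [← φ.apply_symm_apply y, ← hφ, hx, map_zero])
  refine ⟨φ.symm a, φ.symm b, φ.injective ?_⟩
  rw [hφ, φ.apply_symm_apply, φ.apply_symm_apply, hab]

theorem Label.Iso.inLine {l m : Label F} (h : l.Iso m) (hl : m.InLine) : l.InLine := by
  obtain ⟨φ, hφ⟩ := h
  obtain ⟨z, hz⟩ := hl
  refine ⟨φ.symm z, fun x y => ?_⟩
  obtain ⟨c, hc⟩ := hz (φ x) (φ y)
  refine ⟨c, φ.injective ?_⟩
  rw [hφ, hc, map_smul, φ.apply_symm_apply]

theorem hasFourth_S5 : (Label.S5 : Label F).HasFourth :=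
  ⟨![1, 0, 0, 0], fun h => by simpa [Label.prod, prodS5] using congrFun h 3⟩

theorem Label.eq_S5_of_hasFourth {l : Label F} (h : l.HasFourth) : l = .S5 := by
  obtain ⟨x, hx⟩ := h
  cases l with
  | S5 => rfl
  | _ =>
    refine absurd ?_ hx
    ext i
    fin_cases i <;> simp [Label.prod, prodS41, prodS32, prodU1, prodRR]

theorem hasCube_S41 : (Label.S41 : Label F).HasCube :=
  ⟨![1, 0, 0, 0], fun h => by simpa [Label.prod, prodS41] using congrFun h 2⟩

theorem hasCube_S32 : (Label.S32 : Label F).HasCube :=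
  ⟨![1, 0, 0, 0], fun h => by simpa [Label.prod, prodS32] using congrFun h 3⟩

theorem not_hasCube_U1 (α β : F) : ¬(Label.U1 α β).HasCube := by
  rintro ⟨x, hx⟩
  refine hx ?_
  ext i
  fin_cases i <;> simp [Label.prod, prodU1]

theorem not_hasCube_RR (D : Matrix (Fin 3) (Fin 3) F) : ¬(Label.RR D).HasCube := by
  rintro ⟨x, hx⟩
  refine hx ?_
  ext i
  fin_cases i <;> simp [Label.prod, prodRR]

theorem annProd_S32 : (Label.S32 : Label F).AnnProd := by
  intro x hx
  have h1 := congrFun (hx ![1, 0, 0, 0]) 1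
  have h2 := congrFun (hx ![1, 0, 0, 0]) 3
  have h3 := congrFun (hx ![0, 0, 1, 0]) 3
  simp [Label.prod, prodS32] at h1 h2 h3
  refine ⟨![x 3, 0, 0, 0], ![0, 1, 0, 0], ?_⟩
  ext i
  fin_cases i <;> simp [Label.prod, prodS32, h1, h2, h3]

theorem not_annProd_S41 : ¬(Label.S41 : Label F).AnnProd := by
  intro h
  obtain ⟨a, b, hab⟩ := h ![0, 0, 0, 1] (fun y => by
    ext i
    fin_cases i <;> simp [Label.prod, prodS41])
  simpa [Label.prod, prodS41] using congrFun hab 3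

theorem inLine_RR (D : Matrix (Fin 3) (Fin 3) F) : (Label.RR D).InLine := by
  refine ⟨![0, 0, 0, 1], fun x y => ⟨(Label.RR D).prod x y 3, ?_⟩⟩
  ext i
  fin_cases i <;> simp [Label.prod, prodRR]

theorem not_inLine_U1 (α β : F) : ¬(Label.U1 α β).InLine := by
  rintro ⟨z, hz⟩
  obtain ⟨c, hc⟩ := hz ![1, 0, 0, 0] ![1, 0, 0, 0]
  obtain ⟨d, hd⟩ := hz ![1, 0, 0, 0] ![0, 1, 0, 0]
  have h1 := congrFun hc 2
  have h2 := congrFun hc 3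
  have h3 := congrFun hd 2
  have h4 := congrFun hd 3
  simp [Label.prod, prodU1] at h1 h2 h3 h4
  rcases h2 with h | h <;> simp [h] at h1 h4

/-! ### Isomorphisms within the families -/

/-- The entries are the first two coordinates of the images of the generators `e`, `f`; the
equations are the image of `f² = β e² + α e f`. -/
theorem exists_of_iso_U1 {α β α' β' : F} (h : (Label.U1 α β).Iso (Label.U1 α' β')) :
    ∃ p q r s : F, p * s - q * r ≠ 0 ∧
      r ^ 2 + β' * s ^ 2 = β * (p ^ 2 + β' * q ^ 2) + α * (p * r + β' * (q * s)) ∧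
      2 * (r * s) + α' * s ^ 2 =
        β * (2 * (p * q) + α' * q ^ 2) + α * (p * s + q * r + α' * (q * s)) := by
  obtain ⟨φ, hφ⟩ := h
  set e : Fin 4 → F := ![1, 0, 0, 0] with he
  set f : Fin 4 → F := ![0, 1, 0, 0] with hf
  refine ⟨φ e 0, φ e 1, φ f 0, φ f 1, fun hdet => ?_, ?_⟩
  · have key (c d : F) (h0 : c * φ e 0 + d * φ f 0 = 0) (h1 : c * φ e 1 + d * φ f 1 = 0) :
        c = 0 ∧ d = 0 := by
      have h2 : (Label.U1 α β).prod (c • e + d • f) e = 0 := by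
        apply φ.injective
        rw [hφ, map_zero, map_add, map_smul, map_smul]
        ext i
        fin_cases i <;> simp [Label.prod, prodU1, h0, h1]
      have k1 := congrFun h2 2
      have k2 := congrFun h2 3
      simp [Label.prod, prodU1, he, hf] at k1 k2
      exact ⟨k1, k2⟩
    have h1 := key (φ f 1) (-φ e 1) (by linear_combination hdet) (by ring)
    have h2 := key (φ f 0) (-φ e 0) (by ring) (by linear_combination -hdet)
    have h3 := key 1 0 (by linear_combination -h2.2) (by linear_combination -h1.2)
    exact one_ne_zero h3.1
  · have hff : (Label.U1 α β).prod f f =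
        β • (Label.U1 α β).prod e e + α • (Label.U1 α β).prod e f := by
      ext i
      fin_cases i <;> simp [Label.prod, prodU1, he, hf]
    have h := congrArg φ hff
    rw [map_add, map_smul, map_smul, hφ, hφ, hφ] at h
    have h2 := congrFun h 2
    have h3 := congrFun h 3
    simp only [Label.prod, prodU1, Pi.add_apply, Pi.smul_apply, smul_eq_mul, Matrix.cons_val]
      at h2 h3
    exact ⟨by linear_combination h2, by linear_combination h3⟩

/-- If `D ≠ 0`, the last basis vector spans the products, so `φ` preserves its line and induces `P`
on the quotient. For `D = 0` the line need not be preserved, whence the separate case. -/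
theorem projCongruent_of_iso_RR {D D' : Matrix (Fin 3) (Fin 3) F}
    (h : (Label.RR D).Iso (Label.RR D')) : ProjCongruent D' D := by
  obtain ⟨φ, hφ⟩ := h
  by_cases hD : D = 0
  · subst hD
    suffices D' = 0 from ⟨1, one_ne_zero, 1, isUnit_one, by simp [this]⟩
    have h0 (x y : Fin 4 → F) : (Label.RR D').prod x y = 0 := by
      rw [← φ.apply_symm_apply x, ← φ.apply_symm_apply y, ← hφ]
      rw [show (Label.RR (0 : Matrix (Fin 3) (Fin 3) F)).prod (φ.symm x) (φ.symm y) = 0 by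
        ext i
        fin_cases i <;> simp [Label.prod, prodRR], map_zero]
    ext i j
    have := congrFun (h0 (Pi.single i.castSucc 1) (Pi.single j.castSucc 1)) 3
    fin_cases i <;> fin_cases j <;> simpa [Label.prod, prodRR] using this
  · set z : Fin 4 → F := ![0, 0, 0, 1] with hz
    have hbasis (i j : Fin 3) : (Label.RR D).prod (Pi.single i.castSucc 1)
        (Pi.single j.castSucc 1) = D i j • z := by
      ext k
      fin_cases i <;> fin_cases j <;> fin_cases k <;> simp [Label.prod, prodRR, hz]
    have hprod (x y : Fin 4 → F) : (Label.RR D').prod x y = (Label.RR D').prod x y 3 • z := by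
      ext k
      fin_cases k <;> simp [Label.prod, prodRR, hz]
    have hφz : φ z = φ z 3 • z := by
      obtain ⟨i, j, hij⟩ : ∃ i j, D i j ≠ 0 := by
        by_contra! h
        exact hD (Matrix.ext h)
      have h := congrArg φ (hbasis i j)
      rw [hφ, hprod, map_smul] at h
      rw [← inv_smul_smul₀ hij (φ z), ← h]
      simp [hz]
    have hc : φ z 3 ≠ 0 := by
      intro h0
      rw [h0, zero_smul, map_eq_zero_iff φ φ.injective] at hφz
      simpa [hz] using congrFun hφz 3
    refine ⟨φ z 3, hc, Matrix.of fun i j => φ (Pi.single i.castSucc 1) j.castSucc, ?_, ?_⟩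
    · rw [← Matrix.vecMul_injective_iff_isUnit, ← Matrix.coe_vecMulLinear,
        ← LinearMap.ker_eq_bot, LinearMap.ker_eq_bot']
      intro v hv
      set w : Fin 4 → F := ∑ i : Fin 3, v i • Pi.single i.castSucc 1 with hw
      -- A vector in the kernel of `P` lifts to `w` with `φ w` on the line of `z`; then `w` is on
      -- that line too, so `v = 0`.
      have hsum : φ w = φ ((φ w 3 / φ z 3) • z) := by
        rw [map_smul, hφz, smul_smul, Pi.smul_apply, smul_eq_mul,
          show z 3 = 1 from rfl, mul_one, div_mul_cancel₀ _ hc]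
        ext k
        refine Fin.lastCases ?_ (fun k => ?_) k
        · simp [hz, ← Fin.natCast_eq_last]
        · have h0 : φ w k.castSucc = 0 := by
            have hk := congrFun hv k
            simpa [hw, Matrix.vecMul, dotProduct] using hk
          rw [h0]
          fin_cases k <;> simp [hz]
      have := φ.injective hsum
      ext i
      have := congrFun this i.castSucc
      rw [hw] at this
      fin_cases i <;> simpa [Fin.sum_univ_three, hz] using this
    · ext i j
      have h := congrFun (congrArg φ (hbasis i j)) 3
      rw [hφ, map_smul] at h
      simp only [Matrix.mul_apply, Matrix.transpose_apply, Matrix.of_apply, Fin.sum_univ_three,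
        Matrix.smul_apply, smul_eq_mul]
      simp only [Label.prod, prodRR, Matrix.cons_val, Pi.smul_apply, smul_eq_mul] at h
      change (φ (Pi.single i.castSucc 1) 0 * D' 0 0 + φ (Pi.single i.castSucc 1) 1 * D' 1 0 +
          φ (Pi.single i.castSucc 1) 2 * D' 2 0) * φ (Pi.single j.castSucc 1) 0 +
        (φ (Pi.single i.castSucc 1) 0 * D' 0 1 + φ (Pi.single i.castSucc 1) 1 * D' 1 1 +
          φ (Pi.single i.castSucc 1) 2 * D' 2 1) * φ (Pi.single j.castSucc 1) 1 +
        (φ (Pi.single i.castSucc 1) 0 * D' 0 2 + φ (Pi.single i.castSucc 1) 1 * D' 1 2 +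
          φ (Pi.single i.castSucc 1) 2 * D' 2 2) * φ (Pi.single j.castSucc 1) 2 = φ z 3 * D i j
      linear_combination h

theorem eq_zero_of_iso_U1 {β β' : F} (h2 : (2 : F) ≠ 0)
    (h : (Label.U1 0 β).Iso (Label.U1 0 β')) (hβ : β = 0) : β' = 0 := by
  obtain ⟨p, q, r, s, hdet, h1, h3⟩ := exists_of_iso_U1 h
  subst hβ
  simp only [zero_mul, add_zero] at h1 h3
  have hrs : r * s = 0 := (mul_eq_zero.mp h3).resolve_left h2
  rcases mul_eq_zero.mp hrs with h | h
  · have hs : s ≠ 0 := by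
      rintro rfl
      exact hdet (by rw [h]; ring)
    simpa [h, hs] using h1
  · have hr : r = 0 := by simpa [h] using h1
    exact absurd (by rw [h, hr]; ring) hdet

theorem exists_sq_of_iso_U1 {β β' : F} (h2 : (2 : F) ≠ 0) (hβ : β ≠ 0) (hβ' : β' ≠ 0)
    (h : (Label.U1 0 β).Iso (Label.U1 0 β')) : ∃ w : F, w ≠ 0 ∧ β = w ^ 2 * β' := by
  obtain ⟨p, q, r, s, hdet, h1, h3⟩ := exists_of_iso_U1 h
  simp only [zero_mul, add_zero] at h1 h3
  have hrs : r * s = β * (p * q) := by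
    apply mul_left_cancel₀ h2
    linear_combination h3
  suffices h : ∃ w : F, β = w ^ 2 * β' by
    obtain ⟨w, hw⟩ := h
    refine ⟨w, ?_, hw⟩
    rintro rfl
    exact hβ (by rw [hw]; ring)
  by_cases hs : s = 0
  · subst hs
    have hpq : p * q = 0 := by simpa [hβ] using hrs.symm
    have hqr : q * r ≠ 0 := fun h => hdet (by rw [h]; ring)
    have hp : p = 0 := (mul_eq_zero.mp hpq).resolve_right (left_ne_zero_of_mul hqr)
    have hr : r ≠ 0 := right_ne_zero_of_mul hqr
    refine ⟨β * q / r, ?_⟩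
    rw [hp] at h1
    field_simp
    linear_combination h1
  -- Eliminating `r` through `r s = β p q` factors the relation; the second factor would make the
  -- determinant vanish.
  · have hprod : (β * p ^ 2 - β' * s ^ 2) * (β * q ^ 2 - s ^ 2) = 0 := by
      linear_combination s ^ 2 * h1 - (r * s + β * (p * q)) * hrs
    rcases mul_eq_zero.mp hprod with h | h
    · have hp : p ≠ 0 := by
        rintro rfl
        have : β' * s ^ 2 = 0 := by linear_combination -h
        simp [hβ', hs] at this
      refine ⟨s / p, ?_⟩
      field_simp
      linear_combination h
    · refine absurd ?_ hdet
      apply mul_left_cancel₀ hs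
      linear_combination -p * h - q * hrs

theorem star_of_iso_U1 {β β' : F} (h2 : (2 : F) = 0)
    (h : (Label.U1 0 β).Iso (Label.U1 0 β')) : Star β' β := by
  obtain ⟨p, q, r, s, hdet, h1, h3⟩ := exists_of_iso_U1 h
  have hden : p ^ 2 + q ^ 2 * β' ≠ 0 := by
    intro h0
    have h1' : r ^ 2 + β' * s ^ 2 = 0 := by linear_combination h1 + β * h0
    apply hdet
    apply pow_eq_zero_iff two_ne_zero |>.mp
    -- Squaring is additive in characteristic two, so the square of the determinant is `s² p² + q²
    -- r²`, a combination of the two vanishing sums.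
    linear_combination s ^ 2 * h0 - q ^ 2 * h1' + (q ^ 2 * r ^ 2 - p * q * r * s) * h2
  refine ⟨r, s, p, q, fun h => hdet (by linear_combination -h), hden, ?_⟩
  rw [eq_div_iff hden]
  linear_combination -h1

/-- In characteristic two all squares lie on one line when `α = 0`, but not when `α = 1`. Here this
appears as a vanishing determinant. -/
theorem not_iso_U1_zero_one {β β' : F} (h2 : (2 : F) = 0) :
    ¬(Label.U1 1 β).Iso (Label.U1 0 β') := by
  intro h
  obtain ⟨p, q, r, s, hdet, h1, h3⟩ := exists_of_iso_U1 h
  apply hdet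
  linear_combination -h3 + (r * s - β * p * q - q * r) * h2

/-- Invariance of the Arf invariant. Let `N(a + b t) = a² + a b + β b²` be the norm for `t² = t +
β`, and let `Δ` be the determinant. Then `N(s + q t) = Δ` and `N(r + p t) = β' Δ`. The product of `s
+ q t` with the conjugate of `r + p t` is `X + Δ t`, where `X = s r + s p + q p β`, so `X² + X Δ + β
Δ² = β' Δ²`; the witness is `X / Δ`. -/
theorem artinSchreier_of_iso_U1 {β β' : F} (h2 : (2 : F) = 0)
    (h : (Label.U1 1 β).Iso (Label.U1 1 β')) : ∃ l : F, β - β' = l ^ 2 + l := by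
  obtain ⟨p, q, r, s, hdet, h1, h3⟩ := exists_of_iso_U1 h
  refine ⟨(s * r + s * p + q * p * β) / (p * s - q * r), ?_⟩
  have hu : s ^ 2 + s * q + β * q ^ 2 = p * s - q * r := by
    linear_combination h3 + (s * q + β * q ^ 2 + q * r - r * s + β * p * q) * h2
  have hv : r ^ 2 + r * p + β * p ^ 2 = β' * (p * s - q * r) := by
    linear_combination h1 + β' * hu + (r * p + β * p ^ 2 - β' * s ^ 2) * h2
  have huv : (s ^ 2 + s * q + β * q ^ 2) * (r ^ 2 + r * p + β * p ^ 2) =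
      β' * (p * s - q * r) ^ 2 := by
    rw [hu, hv]
    ring
  generalize hX : s * r + s * p + q * p * β = X
  generalize hΔ : p * s - q * r = Δ at hdet
  rw [hΔ] at huv
  field_simp
  subst hX hΔ
  linear_combination -huv + (β * (p * s - q * r) ^ 2 -
    (s * r + s * p + q * p * β) * (p * s - q * r) - β' * (p * s - q * r) ^ 2) * h2

end Separation

theorem IsRepSet.eq_of_rel {A : Type*} {X T : Set A} {r : A → A → Prop} (h : IsRepSet X r T)
    {a b : A} (ha : a ∈ T) (hb : b ∈ T) (haa : r a a) (hab : r a b) : a = b :=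
  (h.2 a (h.1 ha)).unique ⟨ha, haa⟩ ⟨hb, hab⟩

/-! ### Distinct labels give non-isomorphic algebras -/

section Main

variable {F : Type*} [Field F] {Q B C : Set F} {P : Set (Matrix (Fin 3) (Fin 3) F)}

theorem eq_of_iso_U1 (hQ : IsSquareTransversal Q)
    (hB : ringChar F = 2 → IsArtinSchreierTransversal B)
    (hC : ringChar F = 2 → IsRepSet Q Star C) {α β α' β' : F}
    (hl : (Label.U1 α β).Listed Q B C P) (hm : (Label.U1 α' β').Listed Q B C P)
    (h : (Label.U1 α β).Iso (Label.U1 α' β')) : α = α' ∧ β = β' := by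
  rcases hl with ⟨h2, rfl, hβ⟩ | ⟨h2, rfl, hβ⟩ | ⟨h2, rfl, hβ⟩ <;>
  rcases hm with ⟨h2', rfl, hβ'⟩ | ⟨h2', rfl, hβ'⟩ | ⟨h2', rfl, hβ'⟩ <;>
  first | exact absurd h2' h2 | exact absurd h2 h2' | skip
  · refine ⟨rfl, ?_⟩
    have two : (2 : F) ≠ 0 := fun h => h2 (two_eq_zero_iff.mp h)
    by_cases h0 : β = 0
    · rw [h0, eq_zero_of_iso_U1 two h h0]
    · have h0' : β' ≠ 0 := fun h' => h0 (eq_zero_of_iso_U1 two h.symm h')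
      exact hQ.eq_of_rel (hβ.resolve_left h0) (hβ'.resolve_left h0') ⟨1, one_ne_zero, by ring⟩
        (exists_sq_of_iso_U1 two h0 h0' h)
  · refine ⟨rfl, ((hC h2).eq_of_rel hβ' hβ ⟨0, 1, 1, 0, by simp, by simp, by simp⟩ ?_).symm⟩
    exact star_of_iso_U1 (two_eq_zero_iff.mpr h2) h
  · exact absurd h.symm (not_iso_U1_zero_one (two_eq_zero_iff.mpr h2))
  · exact absurd h (not_iso_U1_zero_one (two_eq_zero_iff.mpr h2))
  · refine ⟨rfl, (hB h2).eq_of_rel hβ hβ' ⟨0, by ring⟩ ?_⟩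
    exact artinSchreier_of_iso_U1 (two_eq_zero_iff.mpr h2) h

theorem Label.eq_of_iso (hQ : IsSquareTransversal Q)
    (hB : ringChar F = 2 → IsArtinSchreierTransversal B)
    (hC : ringChar F = 2 → IsRepSet Q Star C) (hP : IsSymmRepSet P) {l m : Label F}
    (hl : l.Listed Q B C P) (hm : m.Listed Q B C P) (h : l.Iso m) : l = m := by
  cases l with
  | S5 => exact (eq_S5_of_hasFourth (h.hasFourth hasFourth_S5)).symm
  | S41 =>
    cases m with
    | S5 => exact eq_S5_of_hasFourth (h.symm.hasFourth hasFourth_S5)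
    | S41 => rfl
    | S32 => exact absurd (h.annProd annProd_S32) not_annProd_S41
    | U1 α β => exact absurd (h.hasCube hasCube_S41) (not_hasCube_U1 α β)
    | RR D => exact absurd (h.hasCube hasCube_S41) (not_hasCube_RR D)
  | S32 =>
    cases m with
    | S5 => exact eq_S5_of_hasFourth (h.symm.hasFourth hasFourth_S5)
    | S41 => exact absurd (h.symm.annProd annProd_S32) not_annProd_S41
    | S32 => rfl
    | U1 α β => exact absurd (h.hasCube hasCube_S32) (not_hasCube_U1 α β)
    | RR D => exact absurd (h.hasCube hasCube_S32) (not_hasCube_RR D)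
  | U1 α β =>
    cases m with
    | S5 => exact eq_S5_of_hasFourth (h.symm.hasFourth hasFourth_S5)
    | S41 => exact absurd (h.symm.hasCube hasCube_S41) (not_hasCube_U1 α β)
    | S32 => exact absurd (h.symm.hasCube hasCube_S32) (not_hasCube_U1 α β)
    | U1 α' β' =>
      obtain ⟨rfl, rfl⟩ := eq_of_iso_U1 hQ hB hC hl hm h
      rfl
    | RR D => exact absurd (h.inLine (inLine_RR D)) (not_inLine_U1 α β)
  | RR D =>
    cases m with
    | S5 => exact eq_S5_of_hasFourth (h.symm.hasFourth hasFourth_S5)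
    | S41 => exact absurd (h.symm.hasCube hasCube_S41) (not_hasCube_RR D)
    | S32 => exact absurd (h.symm.hasCube hasCube_S32) (not_hasCube_RR D)
    | U1 α' β' => exact absurd (h.symm.inLine (inLine_RR D)) (not_inLine_U1 α' β')
    | RR D' =>
      rw [IsRepSet.eq_of_rel hP hl hm ⟨1, one_ne_zero, 1, isUnit_one, by simp⟩
        (projCongruent_of_iso_RR h.symm)]

end Main

end AGL

theorem mainTheorem2 {F : Type*} [Field F]
    (Q B C : Set F) (P : Set (Matrix (Fin 3) (Fin 3) F))
    (hQ : AGL.IsSquareTransversal Q)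
    (hB : ringChar F = 2 → AGL.IsArtinSchreierTransversal B)
    (hC : ringChar F = 2 → AGL.IsRepSet Q AGL.Star C)
    (hP : AGL.IsSymmRepSet P) :
    (∀ l : AGL.Label F, l.Listed Q B C P →
      AGL.IsRegular l.group ∧ AGL.IsAbelian l.group) ∧
    (∀ R : Subgroup (AGL 4 F), AGL.IsRegular R → AGL.IsAbelian R →
      ∃ l : AGL.Label F, l.Listed Q B C P ∧ AGL.AreConj R l.group) ∧
    (∀ l m : AGL.Label F, l.Listed Q B C P → m.Listed Q B C P →
      AGL.AreConj l.group m.group → l = m) := by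
  refine ⟨fun l hl => ⟨l.isRegular_and_prod.1, l.isAbelian hP hl⟩, fun R hR hA => ?_,
    fun l m hl hm h => AGL.Label.eq_of_iso hQ hB hC hP hl hm (AGL.Label.iso_of_areConj h)⟩
  obtain ⟨l, hl, φ, hφ⟩ := AGL.exists_listed_model (AGL.RegAlg.finrank_eq hR hA)
    (AGL.RegAlg.eq_zero_of_add_mul hR hA) hQ hB hC hP
  obtain ⟨hS, hprod⟩ := l.isRegular_and_prod
  refine ⟨l, hl, AGL.areConj_of_equiv (hR := hR) hS φ fun x y => ?_⟩
  rw [hprod]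
  exact hφ x y
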